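/- A numerical semigroup is a set $\Lambda\subseteq\mathbb{N}_0$ that contains $0$, is closed under addition, and has finite complement in $\mathbb{N}_0$. Its multiplicity is $m(\Lambda)=\min(\Lambda\setminus\{0\})$, its conductor is $c(\Lambda)=\min\{c\in\mathbb{N}_0 : c+\mathbb{N}_0\subseteq\Lambda\}$, its Frobenius number is $f(\Lambda)=c(\Lambda)-1$, and its depth is $q(\Lambda)=\lceil c(\Lambda)/m(\Lambda)\rceil$. Theorem. Fix an integer $q\ge 3$. For each positive integer $f$ for which there is a numerical semigroup of depth $q$ with Frobenius number $f$ (this includes all sufficiently large $f$), let $\Lambda_{f,q}$ be chosen uniformly at random from the finite set of all numerical semigroups of depth $q$ with Frobenius number $f$. Then for every $\varepsilon>0$, $$\lim_{f\to\infty}\mathbb{P}\bigl(|f-(q-1)\,m(\Lambda_{f,q})|<\varepsilon f\bigr)=1.$$ -/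

import Mathlib

open Filter Topology

/-- A numerical semigroup: an additive submonoid of `ℕ = {0, 1, 2, …}` with finite complement. -/
structure NumericalSemigroup extends AddSubmonoid ℕ where
  finite_compl : ((carrier : Set ℕ)ᶜ).Finite

namespace NumericalSemigroup

/-- The multiplicity `m(Λ) = min (Λ \ {0})`. -/
noncomputable def multiplicity (Λ : NumericalSemigroup) : ℕ :=
  sInf (Λ.carrier \ {0})

/-- The conductor `c(Λ) = min {c : c + ℕ ⊆ Λ}`. -/
noncomputable def conductor (Λ : NumericalSemigroup) : ℕ :=
  sInf {c : ℕ | ∀ n : ℕ, c + n ∈ Λ.carrier}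

/-- The Frobenius number `f(Λ) = c(Λ) - 1`, an integer (it is `-1` for `Λ = ℕ`). -/
noncomputable def frobenius (Λ : NumericalSemigroup) : ℤ :=
  (Λ.conductor : ℤ) - 1

/-- The depth `q(Λ) = ⌈c(Λ) / m(Λ)⌉`. -/
noncomputable def depth (Λ : NumericalSemigroup) : ℕ :=
  ⌈(Λ.conductor : ℚ) / (Λ.multiplicity : ℚ)⌉₊

theorem conductor_set_nonempty (Λ : NumericalSemigroup) :
    {c : ℕ | ∀ n : ℕ, c + n ∈ Λ.carrier}.Nonempty := by
  obtain ⟨b, hb⟩ := Λ.finite_compl.bddAbove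
  refine ⟨b + 1, fun n => ?_⟩
  by_contra h
  have : b + 1 + n ≤ b := hb h
  omega

/-- The conductor is a genuine minimum. -/
theorem conductor_spec (Λ : NumericalSemigroup) (n : ℕ) :
    Λ.conductor + n ∈ Λ.carrier :=
  Nat.sInf_mem Λ.conductor_set_nonempty n

/-- The multiplicity is a genuine minimum. -/
theorem multiplicity_mem (Λ : NumericalSemigroup) :
    Λ.multiplicity ∈ Λ.carrier \ {0} :=
  Nat.sInf_mem ⟨Λ.conductor + 1, Λ.conductor_spec 1, by simp⟩

/-- Every set of numerical semigroups is an event. -/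
instance : MeasurableSpace NumericalSemigroup := ⊤

/-- The set of numerical semigroups of depth `q` with Frobenius number `f`. -/
def ofDepthFrobenius (q f : ℕ) : Set NumericalSemigroup :=
  {Λ | Λ.depth = q ∧ Λ.frobenius = (f : ℤ)}

/-- There are only finitely many numerical semigroups of given depth and Frobenius number, so that
the uniform distribution on them makes sense as soon as there is one. -/
theorem finite_ofDepthFrobenius (q f : ℕ) : (ofDepthFrobenius q f).Finite := by
  refine Set.Finite.of_finite_image (f := fun Λ : NumericalSemigroup => Λ.carrierᶜ)
    (((Set.finite_Iic f).finite_subsets).subset ?_) ?_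
  · rintro _ ⟨Λ, ⟨-, hf⟩, rfl⟩ x hx
    by_contra hxf
    apply hx
    have hc : Λ.conductor ≤ x := by
      simp only [frobenius, Set.mem_Iic] at hf hxf
      omega
    have := Λ.conductor_spec (x - Λ.conductor)
    rwa [Nat.add_sub_cancel' hc] at this
  · rintro ⟨A, hA⟩ - ⟨B, hB⟩ - h
    have h' : (A : Set ℕ) = B := compl_injective h
    have : A = B := SetLike.coe_injective h'
    subst this
    rfl

end NumericalSemigroup

/-! Write f = (q-1)m + r and Q = `quarterSq`. A semigroup of multiplicity m is encoded by its Kunz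
word k on 1, …, m-1. For depth q and 0 < r < m, the letters are at most q up to r and at most q-1
beyond r. There are at most exp((r/2) log Q(q) + ((m-r)/2) log Q(q-1) + o(m)) such words
(`exists_card_kunzWords_le`). Substituting m = (f-r)/(q-1), the exponent becomes f log
Q(q-1)/(2(q-1)) minus a multiple of r, and the multiple is positive by `mul_log_quarterSq_lt`. This
needs q ≥ 3: for q = 2 the two sides are equal. Explicit words with r < q show that f log
Q(q-1)/(2(q-1)) is attained up to O(1) (`exists_exp_le_ncard`). Hence r ≥ εf is exponentially rare.

For the upper bound, a letter k s = t forces k a + k (s-a) ≥ t for a < s and k a + k (s+m-a) ≥ t-1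
for a > s. Take t to be the largest frequent value, and D its occurrences in the last short block
where it is frequent. Apart from a few positions, letters are at most t through that block and at
most t-1 after it. A single s would leave (u+1)(u+2)/2 choices per pair of letters in [0, u] with
sum at least u. A dense D reduces this to Q(u) by a container argument: boundedly many recorded
letters (`exists_fingerprint`) determine lower bounds L, M with L a + M b ≥ u for almost all pairs
with a + b ∈ D, and (u+1-x)(u+1-y) ≤ Q(u) whenever x + y ≥ u. -/

/-! ### Small subsets and quarter squares -/

open Finset in
/-- The number of subsets of `s` of size at most `τ`, by the exponential-moment method. -/
theorem card_small_subsets_le {α : Type*} (s : Finset α) (τ lam : ℝ) (h0 : 0 < lam)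
    (h1 : lam ≤ 1) :
    ((s.powerset.filter (fun t => (#t : ℝ) ≤ τ)).card : ℝ) ≤
      Real.exp (lam * #s + τ * Real.log (1 / lam)) := by
  have key : ∀ t ∈ s.powerset.filter (fun t => (#t : ℝ) ≤ τ),
      (1 : ℝ) ≤ lam ^ #t * Real.exp (τ * Real.log (1 / lam)) := by
    intro t ht
    have ht' := (mem_filter.1 ht).2
    rw [← Real.exp_log (pow_pos h0 #t), ← Real.exp_add, Real.log_pow, one_div, Real.log_inv]
    apply Real.one_le_exp
    have := Real.log_nonpos h0.le h1
    nlinarith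
  calc ((s.powerset.filter (fun t => (#t : ℝ) ≤ τ)).card : ℝ)
      = ∑ t ∈ s.powerset.filter (fun t => (#t : ℝ) ≤ τ), (1 : ℝ) := by simp
    _ ≤ ∑ t ∈ s.powerset.filter (fun t => (#t : ℝ) ≤ τ),
        lam ^ #t * Real.exp (τ * Real.log (1 / lam)) := sum_le_sum key
    _ ≤ ∑ t ∈ s.powerset, lam ^ #t * Real.exp (τ * Real.log (1 / lam)) :=
        sum_le_sum_of_subset_of_nonneg (filter_subset _ _) (fun _ _ _ => by positivity)
    _ = (lam + 1) ^ #s * Real.exp (τ * Real.log (1 / lam)) := by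
        rw [← sum_mul, ← sum_pow_mul_eq_add_pow]; simp
    _ ≤ Real.exp lam ^ #s * Real.exp (τ * Real.log (1 / lam)) := by
        gcongr
        exact Real.add_one_le_exp lam
    _ = _ := by rw [← Real.exp_nat_mul, ← Real.exp_add, mul_comm lam]

/-- `⌊(u + 2)² / 4⌋`, the largest value of `(u + 1 - x) * (u + 1 - y)` over `x + y ≥ u`. -/
def quarterSq (u : ℕ) : ℕ := (u + 2) ^ 2 / 4

theorem quarterSq_mono : Monotone quarterSq := fun a b h => by
  unfold quarterSq; gcongr

theorem mul_le_quarterSq {u x y : ℕ} (hx : x ≤ u) (hy : y ≤ u) (h : u ≤ x + y) :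
    (u + 1 - x) * (u + 1 - y) ≤ quarterSq u := by
  rw [quarterSq, Nat.le_div_iff_mul_le (by norm_num)]
  obtain ⟨a, rfl⟩ := Nat.exists_eq_add_of_le hx
  obtain ⟨b, hb⟩ := Nat.exists_eq_add_of_le hy
  have e1 : x + a + 1 - x = a + 1 := by omega
  have e2 : x + a + 1 - y = b + 1 := by omega
  rw [e1, e2]
  have : a + b ≤ x + a := by omega
  have h3 : (a + b + 2) ^ 2 ≤ (x + a + 2) ^ 2 := by gcongr
  zify at *
  nlinarith [sq_nonneg ((a : ℤ) - b)]

theorem succ_le_quarterSq (u : ℕ) : u + 1 ≤ quarterSq u := by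
  have := mul_le_quarterSq (u := u) (x := 0) (y := u) (by omega) le_rfl (by omega)
  simpa using this

theorem succ_sq_le_four_mul_quarterSq (u : ℕ) : (u + 1) * (u + 1) ≤ 4 * quarterSq u := by
  have : (u + 2) ^ 2 = (u + 1) * (u + 1) + 2 * u + 3 := by ring
  unfold quarterSq
  omega

/-! ### Containers for words with constrained sums -/

/-- The lower bound at `a` that follows from the values recorded in `T`. -/
def recordedBound (D : Finset ℕ) (u : ℕ) (T : Finset (ℕ × ℕ)) (a : ℕ) : ℕ :=
  (T.filter (fun p => a + p.1 ∈ D)).sup (fun p => u - p.2)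

theorem recordedBound_le (D : Finset ℕ) (u : ℕ) (T : Finset (ℕ × ℕ)) (a : ℕ) :
    recordedBound D u T a ≤ u :=
  Finset.sup_le fun _ _ => Nat.sub_le _ _

theorem recordedBound_mono (D : Finset ℕ) (u : ℕ) {T T' : Finset (ℕ × ℕ)} (h : T ⊆ T') (a : ℕ) :
    recordedBound D u T a ≤ recordedBound D u T' a :=
  Finset.sup_mono (Finset.filter_subset_filter _ h)

theorem le_recordedBound (D : Finset ℕ) (u : ℕ) {T : Finset (ℕ × ℕ)} {p : ℕ × ℕ} (hp : p ∈ T)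
    {a : ℕ} (ha : a + p.1 ∈ D) : u - p.2 ≤ recordedBound D u T a :=
  Finset.le_sup (f := fun p : ℕ × ℕ => u - p.2) (Finset.mem_filter.2 ⟨hp, ha⟩)

open Finset in
/-- A few values of `g` determine, up to few exceptions at each vertex, all its constraints. -/
theorem exists_fingerprint (A B D : Finset ℕ) (u : ℕ) (g : ℕ → ℕ) {θ : ℝ} (hθ : 0 ≤ θ) :
    ∃ T ⊆ B.image (fun b => (b, g b)), (#T : ℝ) * θ ≤ u * #A ∧
      ∀ b ∈ B, (#{a ∈ A | a + b ∈ D ∧ recordedBound D u T a + g b < u} : ℝ) ≤ θ := by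
  -- Each recorded value costs θ against the total lower bound it yields. Comparing the maximizer
  -- with ∅ bounds #T; comparing it with one more recorded value bounds the exceptions.
  obtain ⟨T, hT, hmax⟩ := exists_max_image (B.image (fun b => (b, g b))).powerset
    (fun T => ∑ a ∈ A, (recordedBound D u T a : ℝ) - #T * θ) ⟨∅, by simp⟩
  rw [mem_powerset] at hT
  refine ⟨T, hT, ?_, ?_⟩
  · have h0 := hmax ∅ (by simp)
    have h1 : ∑ a ∈ A, (recordedBound D u T a : ℝ) ≤ ∑ a ∈ A, (u : ℝ) :=
      sum_le_sum fun a _ => by exact_mod_cast recordedBound_le D u T a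
    have h2 : (0 : ℝ) ≤ ∑ a ∈ A, (recordedBound D u ∅ a : ℝ) := by positivity
    simp only [sum_const, nsmul_eq_mul, card_empty, Nat.cast_zero, zero_mul, sub_zero] at h0 h1
    linarith
  · intro b hb
    have hbT : (b, g b) ∈ B.image (fun b => (b, g b)) := mem_image_of_mem _ hb
    by_cases hmem : (b, g b) ∈ T
    · have hE : {a ∈ A | a + b ∈ D ∧ recordedBound D u T a + g b < u} = ∅ := by
        refine filter_eq_empty_iff.2 fun a _ ⟨h1, h2⟩ => ?_
        have := le_recordedBound D u hmem h1
        simp only at this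
        omega
      rw [hE]
      simpa using hθ
    · have h0 := hmax (insert (b, g b) T) (by
        rw [mem_powerset]; exact insert_subset hbT hT)
      rw [card_insert_of_notMem hmem] at h0
      -- Recording g b raises the bound by at least 1 at every exceptional a.
      have h1 : ∑ a ∈ A, (recordedBound D u T a : ℝ) +
          #{a ∈ A | a + b ∈ D ∧ recordedBound D u T a + g b < u} ≤
          ∑ a ∈ A, (recordedBound D u (insert (b, g b) T) a : ℝ) := by
        rw [card_filter, Nat.cast_sum, ← sum_add_distrib]
        refine sum_le_sum fun a _ => ?_
        split_ifs with h
        · have := le_recordedBound D u (mem_insert_self (b, g b) T) h.1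
          have h' := h.2
          simp only at this
          have : recordedBound D u T a + 1 ≤ recordedBound D u (insert (b, g b) T) a := by omega
          exact_mod_cast this
        · have := recordedBound_mono D u (subset_insert (b, g b) T) a
          simpa using this
      push_cast at h0
      linarith

open Finset in
/-- If most of the pairs `a + b ∈ D` satisfy `u ≤ L a + M b`, then the box with lower corner
`(L, M)` and upper values `u` is small. -/
theorem sum_log_box_le {A B D : Finset ℕ} (hD : D.Nonempty) {u : ℕ} {L M : ℕ → ℕ} {θ : ℝ}
    (hABD : ∀ a ∈ A, ∀ s ∈ D, a ≤ s ∧ s - a ∈ B) (hL : ∀ a, L a ≤ u) (hM : ∀ b, M b ≤ u)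
    (hbad : ∀ b ∈ B, (#{a ∈ A | a + b ∈ D ∧ L a + M b < u} : ℝ) ≤ θ) :
    ∑ a ∈ A, Real.log ((u + 1 - L a : ℕ) : ℝ) + ∑ b ∈ B, Real.log ((u + 1 - M b : ℕ) : ℝ) ≤
      #B * (Real.log (quarterSq u) + θ / #D * Real.log 4) := by
  set lc := Real.log (quarterSq u) with hlc
  have hDpos : (0 : ℝ) < #D := by exact_mod_cast hD.card_pos
  have hl4 : 0 ≤ Real.log 4 := Real.log_nonneg (by norm_num)
  have hCpos : (0 : ℝ) < quarterSq u := by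
    exact_mod_cast (Nat.succ_pos u).trans_le (succ_le_quarterSq u)
  have hdegA : ∀ a ∈ A, #{b ∈ B | a + b ∈ D} = #D := fun a ha => by
    refine card_nbij' (fun b => a + b) (fun s => s - a) ?_ ?_ ?_ ?_
    · intro b hb; exact (mem_filter.1 hb).2
    · intro s hs
      have := hABD a ha s hs
      simp only [coe_filter, Set.mem_ofPred_eq]
      exact ⟨this.2, by rwa [Nat.add_sub_cancel' this.1]⟩
    · intro b _; simp
    · intro s hs; exact Nat.add_sub_cancel' (hABD a ha s hs).1
  have hdegB : ∀ b, #{a ∈ A | a + b ∈ D} ≤ #D := fun b =>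
    card_le_card_of_injOn (fun a => a + b) (fun a ha => (mem_filter.1 ha).2)
      (fun a _ a' _ h => by simpa using h)
  -- Every a has exactly #D partners b, so the A-sum can be distributed over B; this is why only #B
  -- enters the bound.
  have hswap : (#D : ℝ) * ∑ a ∈ A, Real.log ((u + 1 - L a : ℕ) : ℝ) =
      ∑ b ∈ B, ∑ a ∈ A with a + b ∈ D, Real.log ((u + 1 - L a : ℕ) : ℝ) := by
    rw [mul_sum]
    simp only [sum_filter]
    rw [sum_comm]
    refine sum_congr rfl fun a ha => ?_
    rw [← sum_filter, sum_const, hdegA a ha, nsmul_eq_mul]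
  -- A violating pair still has at most (u+1)² ≤ 4 Q(u) choices, hence the extra log 4.
  have hedge : ∀ a b, Real.log ((u + 1 - L a : ℕ) : ℝ) + Real.log ((u + 1 - M b : ℕ) : ℝ) ≤
      lc + if L a + M b < u then Real.log 4 else 0 := by
    intro a b
    have hLa := hL a
    have hMb := hM b
    have h1 : (0 : ℝ) < (u + 1 - L a : ℕ) := by exact_mod_cast (by omega : 0 < u + 1 - L a)
    have h2 : (0 : ℝ) < (u + 1 - M b : ℕ) := by exact_mod_cast (by omega : 0 < u + 1 - M b)
    rw [← Real.log_mul h1.ne' h2.ne']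
    split_ifs with h
    · rw [hlc, ← Real.log_mul hCpos.ne' (by norm_num)]
      refine Real.log_le_log (by positivity) ?_
      have := succ_sq_le_four_mul_quarterSq u
      have h3 : (u + 1 - L a) * (u + 1 - M b) ≤ (u + 1) * (u + 1) :=
        Nat.mul_le_mul (Nat.sub_le _ _) (Nat.sub_le _ _)
      rw [mul_comm _ (4 : ℝ)]
      exact_mod_cast h3.trans this
    · rw [add_zero]
      refine Real.log_le_log (by positivity) ?_
      exact_mod_cast mul_le_quarterSq hLa hMb (by omega)
  have hvert : ∀ b, Real.log ((u + 1 - M b : ℕ) : ℝ) ≤ lc := fun b => by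
    have hMb := hM b
    refine Real.log_le_log (by exact_mod_cast (by omega : 0 < u + 1 - M b)) ?_
    exact_mod_cast (Nat.sub_le _ _).trans (succ_le_quarterSq u)
  have hb : ∀ b ∈ B, ∑ a ∈ A with a + b ∈ D, Real.log ((u + 1 - L a : ℕ) : ℝ) +
      #D * Real.log ((u + 1 - M b : ℕ) : ℝ) ≤ #D * lc + θ * Real.log 4 := by
    intro b hb
    have h1 : ∑ a ∈ A with a + b ∈ D,
        (Real.log ((u + 1 - L a : ℕ) : ℝ) + Real.log ((u + 1 - M b : ℕ) : ℝ)) ≤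
        ∑ a ∈ A with a + b ∈ D, (lc + if L a + M b < u then Real.log 4 else 0) :=
      sum_le_sum fun a _ => hedge a b
    rw [sum_add_distrib, sum_add_distrib, ← sum_filter, filter_filter, sum_const, sum_const,
      sum_const, nsmul_eq_mul, nsmul_eq_mul, nsmul_eq_mul] at h1
    have h2 : (#{a ∈ A | a + b ∈ D} : ℝ) ≤ #D := by exact_mod_cast hdegB b
    have h3 := mul_le_mul_of_nonneg_right (hbad b hb) hl4
    -- A vertex b may have fewer than #D partners; each missing one is charged log Q(u).
    have h4 := mul_le_mul_of_nonneg_left (hvert b) (sub_nonneg.2 h2)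
    linarith
  have hsum := sum_le_sum hb
  rw [sum_add_distrib, ← hswap, ← mul_sum, sum_const, nsmul_eq_mul, ← mul_add] at hsum
  rw [← mul_le_mul_iff_right₀ hDpos]
  refine hsum.trans_eq ?_
  field_simp

open Finset in
/-- The words on `A ∪ B` with values at most `u` such that `u ≤ k a + k b` for `a ∈ A` and
`a + b ∈ D`. -/
noncomputable def sumConstrainedWords (A B D : Finset ℕ) (u : ℕ) : Finset (ℕ →₀ ℕ) :=
  ((A ∪ B).finsupp (fun _ => range (u + 1))).filter
    (fun k => ∀ a ∈ A, ∀ s ∈ D, u ≤ k a + k (s - a))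

-- The words are covered by one box per fingerprint T. The first two terms of the exponent count the
-- fingerprints, the last one bounds each box.
open Finset in
theorem card_sumConstrainedWords_le {A B D : Finset ℕ} (hAB : Disjoint A B) (hD : D.Nonempty)
    {u : ℕ} {θ lam : ℝ} (hθ : 0 < θ) (h0 : 0 < lam) (h1 : lam ≤ 1)
    (hABD : ∀ a ∈ A, ∀ s ∈ D, a ≤ s ∧ s - a ∈ B) :
    (#(sumConstrainedWords A B D u) : ℝ) ≤
      Real.exp (lam * (#B * (u + 1)) + u * #A / θ * Real.log (1 / lam) +
        #B * (Real.log (quarterSq u) + θ / #D * Real.log 4)) := by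
  classical
  set I := (B ×ˢ range (u + 1)).powerset.filter (fun T => (#T : ℝ) ≤ u * #A / θ) with hI
  -- The least value at b with at most θ exceptions. It depends on T alone, so T determines the box,
  -- and it is at most k b when T is a fingerprint of k.
  set M : Finset (ℕ × ℕ) → ℕ → ℕ := fun T b =>
    sInf {c | (#{a ∈ A | a + b ∈ D ∧ recordedBound D u T a + c < u} : ℝ) ≤ θ} with hM
  have hMu : ∀ T b, u ∈ {c | (#{a ∈ A | a + b ∈ D ∧ recordedBound D u T a + c < u} : ℝ) ≤ θ} := by
    intro T b
    simpa using hθ.le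
  set box : Finset (ℕ × ℕ) → Finset (ℕ →₀ ℕ) := fun T =>
    (A ∪ B).finsupp (fun i => if i ∈ A then Icc (recordedBound D u T i) u else Icc (M T i) u)
    with hbox
  have hcover : sumConstrainedWords A B D u ⊆ I.biUnion box := by
    intro k hk
    obtain ⟨hk1, hk2⟩ := mem_filter.1 hk
    obtain ⟨hks, hkv⟩ := mem_finsupp_iff.1 hk1
    have hku : ∀ i ∈ A ∪ B, k i ≤ u := fun i hi => by have := mem_range.1 (hkv i hi); omega
    obtain ⟨T, hT, hTc, hTb⟩ := exists_fingerprint A B D u k hθ.le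
    refine mem_biUnion.2 ⟨T, mem_filter.2 ⟨mem_powerset.2 ?_, ?_⟩, ?_⟩
    · intro p hp
      obtain ⟨b, hb, rfl⟩ := mem_image.1 (hT hp)
      exact mem_product.2 ⟨hb, hkv b (mem_union_right _ hb)⟩
    · rwa [le_div_iff₀ hθ]
    · refine mem_finsupp_iff.2 ⟨hks, fun i hi => ?_⟩
      split_ifs with hiA
      · refine mem_Icc.2 ⟨Finset.sup_le fun p hp => ?_, hku i hi⟩
        obtain ⟨hpT, hpD⟩ := mem_filter.1 hp
        obtain ⟨b, hb, rfl⟩ := mem_image.1 (hT hpT)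
        have := hk2 i hiA _ hpD
        simp only [Nat.add_sub_cancel_left] at this ⊢
        omega
      · exact mem_Icc.2 ⟨Nat.sInf_le (hTb i ((mem_union.1 hi).resolve_left hiA)), hku i hi⟩
  have hboxcard : ∀ T ∈ I, (#(box T) : ℝ) ≤
      Real.exp (#B * (Real.log (quarterSq u) + θ / #D * Real.log 4)) := by
    intro T _
    have hMle : ∀ b, M T b ≤ u := fun b => Nat.sInf_le (hMu T b)
    have hlog := sum_log_box_le hD (L := recordedBound D u T) (M := M T) (θ := θ) hABD
      (recordedBound_le D u T) hMle (fun b _ => Nat.sInf_mem ⟨u, hMu T b⟩)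
    refine le_trans (le_of_eq ?_) (Real.exp_le_exp.2 hlog)
    rw [hbox, card_finsupp, prod_union hAB, Real.exp_add, Real.exp_sum, Real.exp_sum]
    push_cast
    congr 1
    · refine prod_congr rfl fun a ha => ?_
      have := recordedBound_le D u T a
      rw [if_pos ha, Nat.card_Icc, Real.exp_log]
      exact_mod_cast (by omega : 0 < u + 1 - recordedBound D u T a)
    · refine prod_congr rfl fun b hb => ?_
      have := hMle b
      rw [if_neg (fun ha => (disjoint_left.1 hAB ha hb).elim), Nat.card_Icc, Real.exp_log]
      exact_mod_cast (by omega : 0 < u + 1 - M T b)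
  have hIcard := card_small_subsets_le (B ×ˢ range (u + 1)) (u * #A / θ) lam h0 h1
  rw [card_product, card_range] at hIcard
  calc (#(sumConstrainedWords A B D u) : ℝ) ≤ #(I.biUnion box) := by
        exact_mod_cast card_le_card hcover
    _ ≤ ∑ T ∈ I, (#(box T) : ℝ) := by exact_mod_cast card_biUnion_le
    _ ≤ ∑ T ∈ I, Real.exp (#B * (Real.log (quarterSq u) + θ / #D * Real.log 4)) :=
        sum_le_sum hboxcard
    _ = #I * Real.exp (#B * (Real.log (quarterSq u) + θ / #D * Real.log 4)) := by
        rw [sum_const, nsmul_eq_mul]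
    _ ≤ _ := by
        rw [Real.exp_add]
        gcongr
        push_cast at hIcard
        exact hIcard

/-! ### Kunz words and words dominated by a frequent value -/

/-- The Kunz inequalities for a word `k` on `1, …, m - 1`. -/
def IsKunzWord (m : ℕ) (k : ℕ →₀ ℕ) : Prop :=
  ∀ i ∈ Finset.Ico 1 m, ∀ j ∈ Finset.Ico 1 m,
    (i + j < m → k (i + j) ≤ k i + k j) ∧ (m < i + j → k (i + j - m) ≤ k i + k j + 1)

open Finset Classical in
/-- Words `k` on `1, …, m - 1` satisfying the Kunz inequalities, with values at most `q` up to the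
position `r` and at most `q - 1` beyond it. -/
noncomputable def kunzWords (m q r : ℕ) : Finset (ℕ →₀ ℕ) :=
  ((Ico 1 m).finsupp (fun i => range ((if i ≤ r then q else q - 1) + 1))).filter (IsKunzWord m)

open Finset in
theorem mem_kunzWords {m q r : ℕ} {k : ℕ →₀ ℕ} : k ∈ kunzWords m q r ↔
    (k.support ⊆ Ico 1 m ∧ ∀ i ∈ Ico 1 m, k i ≤ if i ≤ r then q else q - 1) ∧
      IsKunzWord m k := by
  simp only [kunzWords, mem_filter, mem_finsupp_iff, mem_range, Nat.lt_succ_iff]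

open Finset in
theorem kunzWords_le {m q r : ℕ} {k : ℕ →₀ ℕ} (hk : k ∈ kunzWords m q r) (i : ℕ) : k i ≤ q := by
  obtain ⟨hs, hv⟩ := (mem_kunzWords.1 hk).1
  by_cases hi : i ∈ Ico 1 m
  · have := hv i hi
    split_ifs at this <;> omega
  · have : k i = 0 := Finsupp.notMem_support_iff.1 fun h => hi (hs h)
    omega

open Finset in
/-- The word `k` restricted to `S` and truncated at `u`. -/
noncomputable def clipWord (S : Finset ℕ) (u : ℕ) (k : ℕ →₀ ℕ) : ℕ →₀ ℕ :=
  Finsupp.onFinset S (fun i => if i ∈ S then min (k i) u else 0)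
    (fun i hi => by by_contra h; simp [h] at hi)

theorem clipWord_apply {S : Finset ℕ} {u : ℕ} {k : ℕ →₀ ℕ} {i : ℕ} (hi : i ∈ S) :
    clipWord S u k i = min (k i) u := by
  simp [clipWord, hi]

open Finset in
theorem clipWord_mem {A B D : Finset ℕ} {u : ℕ} {k : ℕ →₀ ℕ}
    (hABD : ∀ a ∈ A, ∀ s ∈ D, s - a ∈ B ∧ u ≤ k a + k (s - a)) :
    clipWord (A ∪ B) u k ∈ sumConstrainedWords A B D u := by
  refine mem_filter.2 ⟨mem_finsupp_iff.2 ⟨Finsupp.support_onFinset_subset, fun i hi => ?_⟩,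
    fun a ha s hs => ?_⟩
  · rw [clipWord_apply hi, mem_range]
    omega
  · obtain ⟨h1, h2⟩ := hABD a ha s hs
    rw [clipWord_apply (mem_union_left _ ha), clipWord_apply (mem_union_right _ h1)]
    omega

/-- The word `k` takes the value `t` on `D`, and outside `E` it is bounded by `t` before the
position `p` and by `t - 1` from there on. -/
def IsDominatedWord (m t p : ℕ) (D E : Finset ℕ) (k : ℕ →₀ ℕ) : Prop :=
  (∀ i ∈ D, k i = t) ∧ ∀ i ∈ Finset.Ico 1 m, i ∉ E → k i ≤ t ∧ (p ≤ i → k i ≤ t - 1)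

open Finset Classical in
/-- The words of `kunzWords m q r` dominated by the value `t`. -/
noncomputable def dominatedWords (m q r t p : ℕ) (D E : Finset ℕ) : Finset (ℕ →₀ ℕ) :=
  (kunzWords m q r).filter (IsDominatedWord m t p D E)

open Finset in
theorem mem_dominatedWords {m q r t p : ℕ} {D E : Finset ℕ} {k : ℕ →₀ ℕ} :
    k ∈ dominatedWords m q r t p D E ↔ k ∈ kunzWords m q r ∧ IsDominatedWord m t p D E k := by
  simp only [dominatedWords, mem_filter]

-- A word is recovered from its letters on E and its truncations at t before p + l and at t - 1
-- afterwards, since outside E nothing is cut off. Splitting near p/2 and (p+m)/2 puts a and its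
-- partner s - a, respectively s + m - a, on opposite sides for every s ∈ D.
open Finset in
theorem card_dominatedWords_le {m q r l t p : ℕ} {D E : Finset ℕ} (hDp : D ⊆ Ico p (p + l))
    (hDm : D ⊆ Ico 1 m) :
    #(dominatedWords m q r t (p + l) D E) ≤
    (q + 1) ^ #E * (#(sumConstrainedWords (Ico 1 (p / 2)) (Ico (p / 2) (p + l)) D t) *
      #(sumConstrainedWords (Ico (p + l) ((p + m) / 2)) (Ico ((p + m) / 2) m)
        (D.image (· + m)) (t - 1))) := by
  classical
  have hE : (q + 1) ^ #E = #(E.finsupp (fun _ => range (q + 1))) := by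
    rw [card_finsupp]; simp
  rw [hE, ← card_product, ← card_product]
  refine card_le_card_of_injOn (fun k => (k.filter (· ∈ E),
    clipWord (Ico 1 (p / 2) ∪ Ico (p / 2) (p + l)) t k,
    clipWord (Ico (p + l) ((p + m) / 2) ∪ Ico ((p + m) / 2) m) (t - 1) k)) ?_ ?_
  · intro k hk
    obtain ⟨hkW, hkD, hkE⟩ := mem_dominatedWords.1 hk
    have hK := (mem_kunzWords.1 hkW).2
    refine mem_product.2 ⟨?_, mem_product.2 ⟨clipWord_mem ?_, clipWord_mem ?_⟩⟩
    · refine mem_finsupp_iff.2 ⟨fun i hi => ?_, fun i hi => ?_⟩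
      · by_contra h
        simp [h] at hi
      · have := kunzWords_le hkW i
        simp only [mem_range, hi, Finsupp.filter_apply_pos]
        omega
    · intro a ha s hs
      have h1 := mem_Ico.1 (hDp hs)
      have h2 := mem_Ico.1 (hDm hs)
      rw [mem_Ico] at ha
      have h3 := (hK a (mem_Ico.2 (by omega)) (s - a) (mem_Ico.2 (by omega))).1 (by omega)
      rw [show a + (s - a) = s by omega, hkD s hs] at h3
      exact ⟨mem_Ico.2 (by omega), h3⟩
    · intro a ha s' hs'
      obtain ⟨s, hs, rfl⟩ := mem_image.1 hs'
      have h1 := mem_Ico.1 (hDp hs)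
      have h2 := mem_Ico.1 (hDm hs)
      rw [mem_Ico] at ha
      have h3 := (hK a (mem_Ico.2 (by omega)) (s + m - a) (mem_Ico.2 (by omega))).2 (by omega)
      rw [show a + (s + m - a) - m = s by omega, hkD s hs] at h3
      exact ⟨mem_Ico.2 (by omega), by omega⟩
  · intro k hk k' hk' heq
    obtain ⟨hkW, -, hkE⟩ := mem_dominatedWords.1 hk
    obtain ⟨hkW', -, hkE'⟩ := mem_dominatedWords.1 hk'
    have hs := (mem_kunzWords.1 hkW).1.1
    have hs' := (mem_kunzWords.1 hkW').1.1
    simp only [Prod.mk.injEq] at heq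
    obtain ⟨e1, e2, e3⟩ := heq
    ext i
    by_cases him : i ∈ Ico 1 m
    swap
    · rw [Finsupp.notMem_support_iff.1 fun h => him (hs h),
        Finsupp.notMem_support_iff.1 fun h => him (hs' h)]
    by_cases hiE : i ∈ E
    · have := DFunLike.congr_fun e1 i
      simpa [hiE] using this
    have b1 := hkE i him hiE
    have b2 := hkE' i him hiE
    rw [mem_Ico] at him
    by_cases hip : p + l ≤ i
    · have hi : i ∈ Ico (p + l) ((p + m) / 2) ∪ Ico ((p + m) / 2) m := by
        rw [mem_union, mem_Ico, mem_Ico]; omega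
      have := DFunLike.congr_fun e3 i
      rw [clipWord_apply hi, clipWord_apply hi] at this
      have := b1.2 hip
      have := b2.2 hip
      omega
    · have hi : i ∈ Ico 1 (p / 2) ∪ Ico (p / 2) (p + l) := by
        rw [mem_union, mem_Ico, mem_Ico]; omega
      have := DFunLike.congr_fun e2 i
      rw [clipWord_apply hi, clipWord_apply hi] at this
      omega

open Finset in
/-- Every word has a largest frequent value `t` and a last block in which it is frequent; few
positions carry values which are rare in their block. -/
theorem exists_frequent_value {m q K l : ℕ} {γ : ℝ} (hγ : 0 ≤ γ) (hl : 0 < l) (hK : m ≤ K * l)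
    (hm : ((q + 1) * K * γ) * m < (m : ℝ) - 1) {k : ℕ → ℕ} (hk : ∀ i ∈ Ico 1 m, k i ≤ q) :
    ∃ t b : ℕ, ∃ D E : Finset ℕ, (∃ i ∈ Ico 1 m, k i = t ∧ i / l = b) ∧
      D = {i ∈ Ico 1 m | k i = t ∧ i / l = b} ∧ γ * m ≤ #D ∧ E ⊆ Ico 1 m ∧
      (#E : ℝ) ≤ ((q + 1) * K * γ) * m ∧
      ∀ i ∈ Ico 1 m, i ∉ E → k i ≤ t ∧ (b * l + l ≤ i → k i ≤ t - 1) := by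
  classical
  set F : ℕ × ℕ → Finset ℕ := fun x => {i ∈ Ico 1 m | k i = x.1 ∧ i / l = x.2} with hF
  set E := {i ∈ Ico 1 m | (#(F (k i, i / l)) : ℝ) < γ * m} with hE
  have hdiv : ∀ i ∈ Ico 1 m, i / l < K := fun i hi => by
    rw [Nat.div_lt_iff_lt_mul hl]
    exact (mem_Ico.1 hi).2.trans_le hK
  have hEcard : (#E : ℝ) ≤ ((q + 1) * K * γ) * m := by
    have hsub : E ⊆ ((range (q + 1) ×ˢ range K).filter (fun x => (#(F x) : ℝ) < γ * m)).biUnion F := by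
      intro i hi
      obtain ⟨hi1, hi2⟩ := mem_filter.1 hi
      refine mem_biUnion.2 ⟨(k i, i / l), mem_filter.2 ⟨mem_product.2 ⟨?_, ?_⟩, hi2⟩, ?_⟩
      · have := hk i hi1
        exact mem_range.2 (by omega)
      · exact mem_range.2 (hdiv i hi1)
      · exact mem_filter.2 ⟨hi1, rfl, rfl⟩
    calc (#E : ℝ) ≤ ∑ x ∈ (range (q + 1) ×ˢ range K).filter (fun x => (#(F x) : ℝ) < γ * m),
          (#(F x) : ℝ) := by exact_mod_cast (card_le_card hsub).trans card_biUnion_le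
      _ ≤ ∑ x ∈ (range (q + 1) ×ˢ range K).filter (fun x => (#(F x) : ℝ) < γ * m), γ * m :=
          sum_le_sum fun x hx => (mem_filter.1 hx).2.le
      _ ≤ ∑ x ∈ range (q + 1) ×ˢ range K, γ * m :=
          sum_le_sum_of_subset_of_nonneg (filter_subset _ _) (fun _ _ _ => by positivity)
      _ = _ := by
          rw [sum_const, nsmul_eq_mul, card_product, card_range, card_range]
          push_cast
          ring
  have hne : (Ico 1 m \ E).Nonempty := by
    rw [sdiff_nonempty]
    intro h
    have h1 := card_le_card h
    rw [Nat.card_Ico] at h1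
    have h2 : ((m : ℝ) - 1) ≤ #E := by
      rw [sub_le_iff_le_add]
      exact_mod_cast (by omega : m ≤ #E + 1)
    linarith
  -- Since i / l < K, this maximizes the pair (value, block) lexicographically.
  obtain ⟨i₀, hi₀, hmax⟩ := exists_max_image (Ico 1 m \ E) (fun i => k i * K + i / l) hne
  obtain ⟨hi1, hi2⟩ := mem_sdiff.1 hi₀
  refine ⟨k i₀, i₀ / l, F (k i₀, i₀ / l), E, ⟨i₀, hi1, rfl, rfl⟩, rfl, ?_, filter_subset _ _,
    hEcard, fun i hi hiE => ?_⟩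
  · by_contra h
    exact hi2 (mem_filter.2 ⟨hi1, not_le.1 h⟩)
  · have h1 := hmax i (mem_sdiff.2 ⟨hi, hiE⟩)
    have h2 := hdiv i hi
    have h3 := hdiv i₀ hi1
    have h4 : k i ≤ k i₀ := by
      by_contra h
      have : (k i₀ + 1) * K ≤ k i * K := Nat.mul_le_mul_right _ (by omega)
      rw [add_mul, one_mul] at this
      have := Nat.zero_le (i / l)
      omega
    refine ⟨h4, fun h => ?_⟩
    have h5 : i₀ / l + 1 ≤ i / l := by
      rw [Nat.le_div_iff_mul_le hl, add_mul]
      omega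
    by_contra h6
    have : k i = k i₀ := by omega
    rw [this] at h1
    omega

/-! ### Exponential bounds for the number of Kunz words -/

-- Taking θ = κ #D with D dense makes the fingerprint size at most q/(κγ), independent of m, while
-- exceptional pairs cost only O(κm).
open Finset in
theorem card_sumConstrainedWords_le_of_dense {A B D : Finset ℕ} (hAB : Disjoint A B) {u q m : ℕ}
    {γ κ lam : ℝ} (hm : 0 < m) (hγ : 0 < γ) (hκ : 0 < κ) (h0 : 0 < lam) (h1 : lam ≤ 1) (hu : u ≤ q)
    (hA : #A ≤ m) (hB : #B ≤ 2 * m) (hD : γ * m ≤ #D)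
    (hABD : ∀ a ∈ A, ∀ s ∈ D, a ≤ s ∧ s - a ∈ B) :
    (#(sumConstrainedWords A B D u) : ℝ) ≤
      Real.exp (lam * (2 * m * (q + 1)) + q / (κ * γ) * Real.log (1 / lam) +
        2 * m * (κ * Real.log 4) + #B * Real.log (quarterSq u)) := by
  have hm' : (0 : ℝ) < m := by exact_mod_cast hm
  have hDpos : (0 : ℝ) < #D := (by positivity : 0 < γ * m).trans_le hD
  have hDne : D.Nonempty := card_pos.1 (by exact_mod_cast hDpos)
  refine (card_sumConstrainedWords_le hAB hDne (mul_pos hκ hDpos) h0 h1 hABD).trans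
    (Real.exp_le_exp.2 ?_)
  have hu' : (u : ℝ) ≤ q := by exact_mod_cast hu
  have hA' : (#A : ℝ) ≤ m := by exact_mod_cast hA
  have hB' : (#B : ℝ) ≤ 2 * m := by exact_mod_cast hB
  have hlog : 0 ≤ Real.log (1 / lam) := Real.log_nonneg (by rw [le_div_iff₀ h0]; linarith)
  have hl4 : 0 ≤ Real.log 4 := Real.log_nonneg (by norm_num)
  have e1 : lam * (#B * (u + 1)) ≤ lam * (2 * m * (q + 1)) := by gcongr
  have e2 : u * #A / (κ * #D) ≤ q / (κ * γ) := by
    calc (u : ℝ) * #A / (κ * #D) ≤ q * m / (κ * (γ * m)) := by gcongr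
      _ = q / (κ * γ) := by field_simp
  have e3 := mul_le_mul_of_nonneg_right e2 hlog
  have e4 : κ * (#D : ℝ) / #D = κ := by field_simp
  rw [e4, mul_add]
  have e5 : (#B : ℝ) * (κ * Real.log 4) ≤ 2 * m * (κ * Real.log 4) := by gcongr
  linarith

theorem log_quarterSq_nonneg (u : ℕ) : 0 ≤ Real.log (quarterSq u) :=
  Real.log_nonneg (by exact_mod_cast (Nat.le_add_left 1 u).trans (succ_le_quarterSq u))

theorem log_quarterSq_mono {u v : ℕ} (h : u ≤ v) :
    Real.log (quarterSq u) ≤ Real.log (quarterSq v) := by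
  refine Real.log_le_log ?_ (by exact_mod_cast quarterSq_mono h)
  exact_mod_cast (Nat.succ_pos u).trans_le (succ_le_quarterSq u)

/-- The exponential growth of the number of Kunz words, up to `o(m)`. -/
noncomputable def kunzExponent (m q r : ℕ) : ℝ :=
  (r / 2 : ℝ) * Real.log (quarterSq q) + ((m - r : ℝ) / 2) * Real.log (quarterSq (q - 1))

/-- If t < q, both rates are at most log Q(q-1). If t = q, the block starts no later than r, and
replacing p by r only increases the share of the larger rate. -/
theorem block_exponent_le {m q r p t : ℕ} (htq : t ≤ q) (hrm : r ≤ m) (hp : t = q → p ≤ r)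
    (hpm : p ≤ m) :
    (p / 2 : ℝ) * Real.log (quarterSq t) + ((m - p : ℝ) / 2) * Real.log (quarterSq (t - 1)) ≤
      kunzExponent m q r := by
  have hrm' : (r : ℝ) ≤ m := by exact_mod_cast hrm
  have hpm' : (p : ℝ) ≤ m := by exact_mod_cast hpm
  have h1 := log_quarterSq_mono (Nat.sub_le q 1)
  have hr0 : (0 : ℝ) ≤ r := by positivity
  have hp0 : (0 : ℝ) ≤ p := by positivity
  unfold kunzExponent
  rcases htq.lt_or_eq with h | rfl
  · have h2 := log_quarterSq_mono (show t ≤ q - 1 by omega)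
    have h3 := log_quarterSq_mono (show t - 1 ≤ q - 1 by omega)
    nlinarith
  · have hp' : (p : ℝ) ≤ r := by exact_mod_cast hp rfl
    nlinarith

open Finset in
theorem card_biUnion_le_card_mul_real {α β : Type*} [DecidableEq β] (s : Finset α)
    (f : α → Finset β) (X : ℝ) (h : ∀ a ∈ s, (#(f a) : ℝ) ≤ X) : (#(s.biUnion f) : ℝ) ≤ #s * X := by
  calc (#(s.biUnion f) : ℝ) ≤ ∑ a ∈ s, (#(f a) : ℝ) := by exact_mod_cast card_biUnion_le
    _ ≤ ∑ a ∈ s, X := sum_le_sum h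
    _ = _ := by rw [sum_const, nsmul_eq_mul]

-- The letters on E are counted trivially. The term with l + 3 absorbs the excess of the two sets B
-- over p/2 and (m-p)/2, which is at most l + 1 and 1.
open Finset in
theorem card_dominatedWords_le_exp {m q r l p t : ℕ} {D E : Finset ℕ} {γ κ lam δ : ℝ}
    (hDp : D ⊆ Ico p (p + l)) (hDm : D ⊆ Ico 1 m) (hm : 0 < m) (hrm : r ≤ m) (hlm : l ≤ m)
    (hγ : 0 < γ) (hκ : 0 < κ) (h0 : 0 < lam) (h1 : lam ≤ 1) (htq : t ≤ q) (hp : t = q → p ≤ r)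
    (hpm : p ≤ m) (hD : γ * m ≤ #D) (hE : (#E : ℝ) ≤ δ * m) :
    (#(dominatedWords m q r t (p + l) D E) : ℝ) ≤
    Real.exp (δ * m * Real.log (q + 1) + 2 * (lam * (2 * m * (q + 1)) +
      q / (κ * γ) * Real.log (1 / lam) + 2 * m * (κ * Real.log 4)) + kunzExponent m q r +
      (l + 3) * Real.log (quarterSq q)) := by
  have hS1 := card_sumConstrainedWords_le_of_dense (A := Ico 1 (p / 2)) (B := Ico (p / 2) (p + l))
    (D := D) (u := t) (Ico_disjoint_Ico_consecutive _ _ _) hm hγ hκ h0 h1 htq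
    (by rw [Nat.card_Ico]; omega) (by rw [Nat.card_Ico]; omega) hD (by
      intro a ha s hs
      have := mem_Ico.1 ha
      have := mem_Ico.1 (hDp hs)
      exact ⟨by omega, mem_Ico.2 (by omega)⟩)
  have hS2 := card_sumConstrainedWords_le_of_dense (A := Ico (p + l) ((p + m) / 2))
    (B := Ico ((p + m) / 2) m) (D := D.image (· + m)) (u := t - 1)
    (Ico_disjoint_Ico_consecutive _ _ _) hm hγ hκ h0 h1 ((Nat.sub_le _ _).trans htq)
    (by rw [Nat.card_Ico]; omega) (by rw [Nat.card_Ico]; omega)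
    (by rwa [card_image_of_injective _ (add_left_injective m)]) (by
      intro a ha s' hs'
      obtain ⟨s, hs, rfl⟩ := mem_image.1 hs'
      have := mem_Ico.1 ha
      have := mem_Ico.1 (hDp hs)
      exact ⟨by omega, mem_Ico.2 (by omega)⟩)
  have hpow : ((q + 1 : ℝ)) ^ #E ≤ Real.exp (δ * m * Real.log (q + 1)) := by
    have hq : (0 : ℝ) < q + 1 := by positivity
    calc ((q + 1 : ℝ)) ^ #E = Real.exp (#E * Real.log (q + 1)) := by
          rw [Real.exp_nat_mul, Real.exp_log hq]
      _ ≤ _ := by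
          have : 0 ≤ Real.log ((q : ℝ) + 1) :=
            Real.log_nonneg (le_add_of_nonneg_left (by positivity))
          gcongr
  have hmain := Nat.cast_le (α := ℝ) |>.2 <| card_dominatedWords_le (q := q) (r := r) (t := t) (E := E) hDp hDm
  push_cast at hmain
  have hexp := block_exponent_le htq hrm hp hpm
  have hB1 : (#(Ico (p / 2) (p + l)) : ℝ) ≤ p / 2 + l + 1 := by
    rw [Nat.card_Ico]
    have : 2 * (p + l - p / 2) ≤ p + 2 * l + 2 := by omega
    have : (2 : ℝ) * (p + l - p / 2 : ℕ) ≤ p + 2 * l + 2 := by exact_mod_cast this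
    linarith
  have hB2 : (#(Ico ((p + m) / 2) m) : ℝ) ≤ (m - p) / 2 + 1 := by
    rw [Nat.card_Ico]
    have : 2 * (m - (p + m) / 2) + p ≤ m + 2 := by omega
    have : (2 : ℝ) * (m - (p + m) / 2 : ℕ) + p ≤ m + 2 := by exact_mod_cast this
    linarith
  have e1 := mul_le_mul_of_nonneg_right hB1 (log_quarterSq_nonneg t)
  have e2 := mul_le_mul_of_nonneg_right hB2 (log_quarterSq_nonneg (t - 1))
  have e3 := log_quarterSq_mono htq
  have e4 := log_quarterSq_mono ((Nat.sub_le t 1).trans htq)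
  have e5 := mul_le_mul_of_nonneg_left e3 (by positivity : (0 : ℝ) ≤ l + 1)
  have e6 := log_quarterSq_nonneg q
  refine hmain.trans ((mul_le_mul hpow (mul_le_mul hS1 hS2 (by positivity) (by positivity))
    (by positivity) (by positivity)).trans ?_)
  rw [← Real.exp_add, ← Real.exp_add]
  apply Real.exp_le_exp.2
  linarith

-- Union bound over the value and block of the frequent letter, over D inside a block of length l,
-- and over the small exceptional set E.
open Finset in
theorem card_kunzWords_le_of_params {m q r K l : ℕ} {γ κ lam lam' : ℝ} (hq : 0 < q) (hm : 0 < m) (hrm : r ≤ m)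
    (hl : 0 < l) (hlm : l ≤ m) (hK : m ≤ K * l) (hγ : 0 < γ) (hκ : 0 < κ) (h0 : 0 < lam)
    (h1 : lam ≤ 1) (h0' : 0 < lam') (h1' : lam' ≤ 1)
    (hmδ : ((q + 1) * K * γ) * m < (m : ℝ) - 1) :
    (#(kunzWords m q r) : ℝ) ≤ ((q + 1) * K) * ((2 ^ l * Real.exp (lam' * m +
      ((q + 1) * K * γ) * m * Real.log (1 / lam'))) *
    Real.exp (((q + 1) * K * γ) * m * Real.log (q + 1) + 2 * (lam * (2 * m * (q + 1)) +
      q / (κ * γ) * Real.log (1 / lam) + 2 * m * (κ * Real.log 4)) + kunzExponent m q r +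
      (l + 3) * Real.log (quarterSq q))) := by
  classical
  set δ : ℝ := (q + 1) * K * γ with hδ
  set X := Real.exp (δ * m * Real.log (q + 1) + 2 * (lam * (2 * m * (q + 1)) +
      q / (κ * γ) * Real.log (1 / lam) + 2 * m * (κ * Real.log 4)) + kunzExponent m q r +
      (l + 3) * Real.log (quarterSq q)) with hX
  set I := (Ico 1 m).powerset.filter (fun t => (#t : ℝ) ≤ δ * m) with hI
  set J : ℕ → Finset (Finset ℕ) := fun b =>
    (Ico (b * l) (b * l + l)).powerset.filter (fun D => D ⊆ Ico 1 m ∧ γ * m ≤ #D) with hJ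
  set P := (range (q + 1) ×ˢ range K).filter
    (fun x => (x.1 = q → x.2 * l ≤ r) ∧ x.2 * l ≤ m) with hP
  set G : ℕ × ℕ → Finset ℕ × Finset ℕ → Finset (ℕ →₀ ℕ) := fun x y =>
    dominatedWords m q r x.1 (x.2 * l + l) y.1 y.2 with hG
  have hcover : kunzWords m q r ⊆ P.biUnion fun x => (J x.2 ×ˢ I).biUnion (G x) := by
    intro k hk
    obtain ⟨t, b, D, E, ⟨i, hi, hit, hib⟩, hD, hDc, hE, hEc, hkE⟩ :=
      exists_frequent_value hγ.le hl hK hmδ (k := k) (fun i _ => kunzWords_le hk i)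
    have hbl : b * l ≤ i := by rw [← hib]; exact Nat.div_mul_le_self i l
    have him := mem_Ico.1 hi
    refine mem_biUnion.2 ⟨(t, b), mem_filter.2 ⟨mem_product.2 ⟨?_, ?_⟩, ?_, ?_⟩,
      mem_biUnion.2 ⟨(D, E), mem_product.2 ⟨mem_filter.2 ⟨?_, ?_, hDc⟩, ?_⟩, ?_⟩⟩
    · have := kunzWords_le hk i
      exact mem_range.2 (by omega)
    · rw [mem_range]
      by_contra h
      have : K * l ≤ b * l := Nat.mul_le_mul_right _ (not_lt.1 h)
      omega
    -- The letter q occurs only at positions up to r, so its block starts there.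
    · intro (htq : t = q)
      change b * l ≤ r
      have h := (mem_kunzWords.1 hk).1.2 i hi
      by_contra h'
      rw [if_neg (by omega)] at h
      omega
    · change b * l ≤ m
      omega
    · rw [mem_powerset]
      intro j hj
      rw [hD] at hj
      obtain ⟨-, -, hj⟩ := mem_filter.1 hj
      change j ∈ Ico (b * l) (b * l + l)
      have h1 := Nat.div_add_mod j l
      have h2 := Nat.mod_lt j hl
      rw [hj, mul_comm] at h1
      exact mem_Ico.2 (by omega)
    · rw [hD]; exact filter_subset _ _
    · exact mem_filter.2 ⟨mem_powerset.2 hE, hEc⟩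
    · refine mem_dominatedWords.2 ⟨hk, fun j hj => ?_, hkE⟩
      rw [hD] at hj
      exact (mem_filter.1 hj).2.1
  have hGle : ∀ x ∈ P, ∀ y ∈ J x.2 ×ˢ I, (#(G x y) : ℝ) ≤ X := by
    intro x hx y hy
    obtain ⟨hx1, hx2, hx3⟩ := mem_filter.1 hx
    obtain ⟨hy1, hy2⟩ := mem_product.1 hy
    obtain ⟨hy3, hy4, hy5⟩ := mem_filter.1 hy1
    have hx4 := mem_range.1 (mem_product.1 hx1).1
    exact card_dominatedWords_le_exp (mem_powerset.1 hy3) hy4 hm hrm hlm hγ hκ h0 h1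
      (by omega) hx2 hx3 hy5 (mem_filter.1 hy2).2
  have hIc : (#I : ℝ) ≤ Real.exp (lam' * m + δ * m * Real.log (1 / lam')) := by
    refine (card_small_subsets_le _ _ lam' h0' h1').trans (Real.exp_le_exp.2 ?_)
    have : (#(Ico 1 m) : ℝ) ≤ m := by rw [Nat.card_Ico]; exact_mod_cast Nat.sub_le _ _
    gcongr
  have hJc : ∀ b, (#(J b) : ℝ) ≤ 2 ^ l := by
    intro b
    have : #(J b) ≤ #(Ico (b * l) (b * l + l)).powerset := card_filter_le _ _
    rw [card_powerset, Nat.card_Ico, Nat.add_sub_cancel_left] at this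
    exact_mod_cast this
  have hPc : (#P : ℝ) ≤ (q + 1) * K := by
    have : #P ≤ #(range (q + 1) ×ˢ range K) := card_filter_le _ _
    rw [card_product, card_range, card_range] at this
    exact_mod_cast this
  refine (Nat.cast_le.2 (card_le_card hcover)).trans ?_
  refine (card_biUnion_le_card_mul_real P _ ((2 ^ l * Real.exp (lam' * m +
    δ * m * Real.log (1 / lam'))) * X) fun x hx => ?_).trans (by gcongr)
  refine (card_biUnion_le_card_mul_real _ _ X (hGle x hx)).trans ?_
  rw [card_product, Nat.cast_mul]
  gcongr
  exact hJc _

open Finset in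
/-- The number of Kunz words is at most `exp (kunzExponent m q r + o(m))`. -/
theorem exists_card_kunzWords_le {q : ℕ} (hq : 0 < q) {β : ℝ} (hβ : 0 < β) :
    ∃ C₀ : ℝ, ∀ m r : ℕ, 2 ≤ m → r ≤ m →
      (#(kunzWords m q r) : ℝ) ≤ Real.exp (C₀ + β * m + kunzExponent m q r) := by
  have hl2 : 0 < Real.log 2 := Real.log_pos (by norm_num)
  have hl4 : 0 < Real.log 4 := Real.log_pos (by norm_num)
  have ha := log_quarterSq_nonneg q
  -- The error βm is split into five shares of β/5, governed by K (block length), lam' (choice of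
  -- E), δ (size of E), lam (fingerprints) and κ (exceptional pairs). As Y involves lam', δ comes
  -- after it.
  obtain ⟨K, hK2, hKX⟩ : ∃ K : ℕ, 2 ≤ K ∧ (Real.log 2 + Real.log (quarterSq q)) * 5 / β ≤ K := by
    obtain ⟨K, hK⟩ := exists_nat_ge ((Real.log 2 + Real.log (quarterSq q)) * 5 / β)
    exact ⟨K + 2, by omega, by push_cast; linarith⟩
  obtain ⟨lam', h0', h1', hlam'⟩ : ∃ lam' : ℝ, 0 < lam' ∧ lam' ≤ 1 ∧ lam' ≤ β / 5 :=
    ⟨min 1 (β / 5), by positivity, min_le_left _ _, min_le_right _ _⟩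
  obtain ⟨lam, h0, h1, hlam⟩ : ∃ lam : ℝ, 0 < lam ∧ lam ≤ 1 ∧ lam ≤ β / (20 * (q + 1)) :=
    ⟨min 1 (β / (20 * (q + 1))), by positivity, min_le_left _ _, min_le_right _ _⟩
  have hY0 : 0 ≤ Real.log (1 / lam') := Real.log_nonneg (by rw [le_div_iff₀ h0']; linarith)
  have hY1 : 0 ≤ Real.log ((q : ℝ) + 1) :=
    Real.log_nonneg (le_add_of_nonneg_left (by positivity))
  set Y := Real.log (1 / lam') + Real.log (q + 1) with hY
  -- The bound 1/4 ensures δm < m - 1 for all m ≥ 2.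
  obtain ⟨δ, hδ0, hδ1, hδ⟩ : ∃ δ : ℝ, 0 < δ ∧ δ ≤ 1 / 4 ∧ δ * Y ≤ β / 5 := by
    refine ⟨min (1 / 4) (β / 5 / (Y + 1)), by positivity, min_le_left _ _, ?_⟩
    have : min (1 / 4) (β / 5 / (Y + 1)) ≤ β / 5 / (Y + 1) := min_le_right _ _
    rw [le_div_iff₀ (by positivity)] at this
    have h0 : 0 < min (1 / 4) (β / 5 / (Y + 1)) := by positivity
    nlinarith
  set γ := δ / ((q + 1) * K) with hγ
  set κ := β / (20 * Real.log 4) with hκ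
  have hK0 : (0 : ℝ) < K := by exact_mod_cast (by omega : 0 < K)
  have hγδ : (q + 1) * K * γ = δ := by rw [hγ]; field_simp
  refine ⟨Real.log ((q + 1) * K) + (Real.log 2 + Real.log (quarterSq q)) +
    3 * Real.log (quarterSq q) + 2 * (q / (κ * γ) * Real.log (1 / lam)), fun m r hm hrm => ?_⟩
  have hm2 : (2 : ℝ) ≤ m := by exact_mod_cast hm
  have hlm : m / K + 1 ≤ m := by
    have : m / K ≤ m / 2 := Nat.div_le_div_left hK2 (by norm_num)
    omega
  have hmain := card_kunzWords_le_of_params (l := m / K + 1) (γ := γ) (κ := κ) hq (by omega) hrm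
    (Nat.succ_pos _) hlm (Nat.lt_mul_div_succ m (by omega)).le (by positivity) (by positivity)
    h0 h1 h0' h1' (by rw [hγδ]; nlinarith)
  rw [hγδ] at hmain
  have hl : ((m / K + 1 : ℕ) : ℝ) ≤ m / K + 1 := by
    push_cast
    have := Nat.cast_div_le (α := ℝ) (m := m) (n := K)
    linarith
  have e1 : ((m / K + 1 : ℕ) : ℝ) * (Real.log 2 + Real.log (quarterSq q)) ≤
      m * (β / 5) + (Real.log 2 + Real.log (quarterSq q)) := by
    have h := mul_le_mul_of_nonneg_right hl (by positivity :
      0 ≤ Real.log 2 + Real.log (quarterSq q))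
    have h' : (m : ℝ) / K * (Real.log 2 + Real.log (quarterSq q)) ≤ m * (β / 5) := by
      rw [div_mul_eq_mul_div, mul_div_assoc]
      refine mul_le_mul_of_nonneg_left ?_ (by positivity)
      rw [div_le_iff₀ hβ] at hKX
      rw [div_le_iff₀ hK0]
      linarith
    linarith
  have e2 : lam' * m ≤ β / 5 * m := by gcongr
  have e3 : δ * Y * m ≤ β / 5 * m := by gcongr
  have e4 : lam * (2 * m * (q + 1)) ≤ β / (20 * (q + 1)) * (2 * m * (q + 1)) := by gcongr
  have e4' : β / (20 * (q + 1)) * (2 * m * (q + 1)) = β / 10 * m := by field_simp; norm_num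
  have e5 : 2 * m * (κ * Real.log 4) = β / 10 * m := by rw [hκ]; field_simp; norm_num
  have e6 : ((q + 1) * K : ℝ) = Real.exp (Real.log ((q + 1) * K)) :=
    (Real.exp_log (by positivity)).symm
  have e7 : (2 : ℝ) ^ (m / K + 1) = Real.exp ((m / K + 1 : ℕ) * Real.log 2) := by
    rw [Real.exp_nat_mul, Real.exp_log (by norm_num)]
  refine hmain.trans ?_
  rw [e5, e7]
  nth_rewrite 1 [e6]
  rw [← Real.exp_add, ← Real.exp_add, ← Real.exp_add]
  apply Real.exp_le_exp.2
  rw [hY] at e3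
  linarith

/-! ### The gap between consecutive growth rates -/

/-- Depth `q ≥ 3` is where `quarterSq q ^ (1 / q)` falls short of
`quarterSq (q - 1) ^ (1 / (q - 1))`. -/
theorem mul_log_quarterSq_lt {q : ℕ} (hq : 3 ≤ q) :
    ((q : ℝ) - 1) * Real.log (quarterSq q) < q * Real.log (quarterSq (q - 1)) := by
  obtain rfl | rfl | hq5 : q = 3 ∨ q = 4 ∨ 5 ≤ q := by omega
  · have h := Real.log_lt_log (by norm_num) (by norm_num : (6 : ℝ) ^ 2 < 4 ^ 3)
    rw [Real.log_pow, Real.log_pow] at h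
    norm_num [quarterSq] at h ⊢
    linarith
  · have h := Real.log_lt_log (by norm_num) (by norm_num : (9 : ℝ) ^ 3 < 6 ^ 4)
    rw [Real.log_pow, Real.log_pow] at h
    norm_num [quarterSq] at h ⊢
    linarith
  -- Here Q(q)/Q(q-1) ≤ (q+2)/q, so the logarithms differ by at most 2/q, while Q(q-1) > 8 gives log
  -- Q(q-1) > 2 ≥ (q-1)·2/q.
  · have hq0 : (0 : ℝ) < q := by exact_mod_cast (by omega : 0 < q)
    have hq5' : (5 : ℝ) ≤ q := by exact_mod_cast hq5
    have hP : 4 * (quarterSq q : ℝ) ≤ (q + 2) ^ 2 := by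
      have : 4 * quarterSq q ≤ (q + 2) ^ 2 := Nat.mul_div_le _ _
      exact_mod_cast this
    have hQ : (q : ℝ) * (q + 2) ≤ 4 * quarterSq (q - 1) := by
      obtain ⟨p, rfl⟩ : ∃ p, q = p + 1 := ⟨q - 1, by omega⟩
      have h : (p + 1) * (p + 3) ≤ 4 * quarterSq p := by
        unfold quarterSq
        have : (p + 2) ^ 2 = (p + 1) * (p + 3) + 1 := by ring
        have hmod : (p + 2) ^ 2 % 4 = 0 ∨ (p + 2) ^ 2 % 4 = 1 := by
          rcases Nat.even_or_odd' (p + 2) with ⟨c, hc | hc⟩ <;> rw [hc]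
          · left; ring_nf; omega
          · right; ring_nf; omega
        omega
      have := (Nat.cast_le (α := ℝ)).2 h
      push_cast at this ⊢
      linarith
    have hP0 : (0 : ℝ) < quarterSq q := by
      exact_mod_cast (Nat.succ_pos q).trans_le (succ_le_quarterSq q)
    have hQ9 : (8 : ℝ) < quarterSq (q - 1) := by nlinarith
    have hQ0 : (0 : ℝ) < quarterSq (q - 1) := by linarith
    have hratio : Real.log (quarterSq q) - Real.log (quarterSq (q - 1)) ≤ 2 / q := by
      rw [← Real.log_div hP0.ne' hQ0.ne']
      refine (Real.log_le_sub_one_of_pos (by positivity)).trans ?_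
      rw [sub_le_iff_le_add, div_le_iff₀ hQ0]
      have : (2 / q + 1 : ℝ) * quarterSq (q - 1) = (q + 2) * (4 * quarterSq (q - 1)) / (4 * q) := by
        field_simp; ring
      rw [this, le_div_iff₀ (by positivity)]
      nlinarith
    have hlog8 : (2 : ℝ) < Real.log (quarterSq (q - 1)) := by
      have h := Real.log_lt_log (by norm_num) hQ9
      have h8 : Real.log 8 = 3 * Real.log 2 := by
        rw [show (8 : ℝ) = 2 ^ 3 by norm_num, Real.log_pow]; norm_num
      have := Real.log_two_gt_d9
      linarith
    have h1 : ((q : ℝ) - 1) * (2 / q) ≤ 2 := by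
      rw [mul_div_assoc', div_le_iff₀ hq0]; linarith
    have h2 := mul_le_mul_of_nonneg_left hratio (by linarith : (0 : ℝ) ≤ q - 1)
    linarith

/-! ### Numerical semigroups and their Kunz words -/

namespace NumericalSemigroup

theorem ext_carrier {Λ Λ' : NumericalSemigroup} (h : ∀ n, n ∈ Λ.carrier ↔ n ∈ Λ'.carrier) :
    Λ = Λ' := by
  obtain ⟨A, hA⟩ := Λ
  obtain ⟨B, hB⟩ := Λ'
  have : A = B := AddSubmonoid.ext h
  subst this
  rfl

theorem multiplicity_pos (Λ : NumericalSemigroup) : 0 < Λ.multiplicity :=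
  Nat.pos_of_ne_zero Λ.multiplicity_mem.2

theorem mem_of_conductor_le (Λ : NumericalSemigroup) {n : ℕ} (h : Λ.conductor ≤ n) :
    n ∈ Λ.carrier := by
  have := Λ.conductor_spec (n - Λ.conductor)
  rwa [Nat.add_sub_cancel' h] at this

theorem mul_multiplicity_mem (Λ : NumericalSemigroup) (k : ℕ) :
    k * Λ.multiplicity ∈ Λ.carrier := by
  have := Λ.toAddSubmonoid.nsmul_mem (x := Λ.multiplicity) Λ.multiplicity_mem.1 k
  simpa using this

open Finset in
/-- The Kunz word of `Λ`: at `i ∈ [1, m)` the least `k` with `k m + i ∈ Λ`. -/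
noncomputable def kunzWord (Λ : NumericalSemigroup) : ℕ →₀ ℕ :=
  Finsupp.onFinset (Ico 1 Λ.multiplicity)
    (fun i => if i ∈ Ico 1 Λ.multiplicity then
      sInf {k | k * Λ.multiplicity + i ∈ Λ.carrier} else 0)
    (fun i hi => by by_contra h; simp only [h, if_false] at hi; exact hi rfl)

theorem kunzWord_le_iff (Λ : NumericalSemigroup) {i : ℕ} (hi : i ∈ Finset.Ico 1 Λ.multiplicity)
    (k : ℕ) : Λ.kunzWord i ≤ k ↔ k * Λ.multiplicity + i ∈ Λ.carrier := by
  have hval : Λ.kunzWord i = sInf {k | k * Λ.multiplicity + i ∈ Λ.carrier} := by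
    simp only [kunzWord, Finsupp.onFinset_apply, if_pos hi]
  have hne : {k | k * Λ.multiplicity + i ∈ Λ.carrier}.Nonempty := by
    refine ⟨Λ.conductor, Λ.mem_of_conductor_le ?_⟩
    exact (Nat.le_mul_of_pos_right _ Λ.multiplicity_pos).trans (Nat.le_add_right _ _)
  rw [hval]
  refine ⟨fun h => ?_, fun h => Nat.sInf_le h⟩
  have h1 : sInf {k | k * Λ.multiplicity + i ∈ Λ.carrier} * Λ.multiplicity + i ∈ Λ.carrier :=
    Nat.sInf_mem hne
  set s := sInf {k | k * Λ.multiplicity + i ∈ Λ.carrier}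
  have h2 := Λ.toAddSubmonoid.add_mem h1 (Λ.mul_multiplicity_mem (k - s))
  have h3 : s * Λ.multiplicity + i + (k - s) * Λ.multiplicity = k * Λ.multiplicity + i := by
    obtain ⟨d, rfl⟩ := Nat.exists_eq_add_of_le h
    rw [Nat.add_sub_cancel_left]
    ring
  rw [h3] at h2
  exact h2

theorem eq_of_kunzWord_eq {Λ Λ' : NumericalSemigroup} (hm : Λ.multiplicity = Λ'.multiplicity)
    (hw : Λ.kunzWord = Λ'.kunzWord) : Λ = Λ' := by
  refine ext_carrier fun n => ?_
  have hn := Nat.div_add_mod' n Λ.multiplicity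
  have hlt := Nat.mod_lt n Λ.multiplicity_pos
  rcases Nat.eq_zero_or_pos (n % Λ.multiplicity) with h0 | h0
  · rw [h0, add_zero] at hn
    have h1 := Λ.mul_multiplicity_mem (n / Λ.multiplicity)
    have h2 := Λ'.mul_multiplicity_mem (n / Λ.multiplicity)
    rw [← hm] at h2
    rw [hn] at h1 h2
    exact iff_of_true h1 h2
  · have h1 := Λ.kunzWord_le_iff (Finset.mem_Ico.2 ⟨h0, hlt⟩) (n / Λ.multiplicity)
    have h2 := Λ'.kunzWord_le_iff (i := n % Λ.multiplicity)
      (Finset.mem_Ico.2 ⟨h0, hm ▸ hlt⟩) (n / Λ.multiplicity)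
    rw [← hm, hn, ← hw] at h2
    rw [hn] at h1
    exact h1.symm.trans h2

-- The Kunz inequalities are closure under addition read modulo m. The caps hold because (q-1)m + i
-- for i > r, and qm + i for every i, reach the conductor.
open Finset in
theorem kunzWord_mem_kunzWords (Λ : NumericalSemigroup) {q r : ℕ} (hq : 0 < q)
    (hr : r < Λ.multiplicity) (hc : Λ.conductor ≤ (q - 1) * Λ.multiplicity + r + 1) :
    Λ.kunzWord ∈ kunzWords Λ.multiplicity q r := by
  have hqm : q * Λ.multiplicity = (q - 1) * Λ.multiplicity + Λ.multiplicity := by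
    obtain ⟨p, rfl⟩ : ∃ p, q = p + 1 := ⟨q - 1, by omega⟩
    simp only [Nat.add_sub_cancel]
    ring
  refine mem_kunzWords.2 ⟨⟨Finsupp.support_onFinset_subset, fun i hi => ?_⟩,
    fun i hi j hj => ⟨fun hij => ?_, fun hij => ?_⟩⟩
  · rw [kunzWord_le_iff Λ hi]
    apply Λ.mem_of_conductor_le
    split_ifs <;> omega
  all_goals
    have h1 := (Λ.kunzWord_le_iff hi _).1 le_rfl
    have h2 := (Λ.kunzWord_le_iff hj _).1 le_rfl
    have h3 := Λ.toAddSubmonoid.add_mem h1 h2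
    rw [mem_Ico] at hi hj
    rw [kunzWord_le_iff Λ (mem_Ico.2 (by omega))]
    refine Set.mem_of_eq_of_mem ?_ h3
    simp only [add_mul, one_mul]
    omega

theorem depth_eq_iff (Λ : NumericalSemigroup) {q : ℕ} (hq : 0 < q) :
    Λ.depth = q ↔ (q - 1) * Λ.multiplicity < Λ.conductor ∧
      Λ.conductor ≤ q * Λ.multiplicity := by
  have hm : (0 : ℚ) < Λ.multiplicity := by exact_mod_cast Λ.multiplicity_pos
  rw [depth, Nat.ceil_eq_iff hq.ne', lt_div_iff₀ hm, div_le_iff₀ hm]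
  norm_cast

/-- The numerical semigroup with prescribed Kunz word. -/
def ofWord (m b : ℕ) (w : ℕ → ℕ) (hm : 0 < m) (h0 : w 0 = 0) (hb : ∀ i, w i ≤ b)
    (h1 : ∀ i < m, ∀ j < m, i + j < m → w (i + j) ≤ w i + w j)
    (h2 : ∀ i < m, ∀ j < m, m ≤ i + j → w (i + j - m) ≤ w i + w j + 1) : NumericalSemigroup where
  carrier := {n | w (n % m) ≤ n / m}
  zero_mem' := by simp [h0]
  add_mem' := by
    intro a c ha hc
    have ha' : w (a % m) ≤ a / m := ha
    have hc' : w (c % m) ≤ c / m := hc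
    change w ((a + c) % m) ≤ (a + c) / m
    have hla := Nat.mod_lt a hm
    have hlc := Nat.mod_lt c hm
    rw [Nat.add_div hm, Nat.add_mod]
    split_ifs with h
    · have := h2 _ hla _ hlc h
      rw [Nat.mod_eq_sub_mod h, Nat.mod_eq_of_lt (by omega)]
      omega
    · have := h1 _ hla _ hlc (by omega)
      rw [Nat.mod_eq_of_lt (by omega)]
      omega
  finite_compl := by
    refine (Set.finite_Iio (b * m)).subset fun n hn => ?_
    by_contra h
    refine hn ((hb _).trans ?_)
    rw [Nat.le_div_iff_mul_le hm]
    exact not_lt.1 h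

theorem mul_add_mem_ofWord {m b : ℕ} {w : ℕ → ℕ} {hm : 0 < m} {h0 : w 0 = 0} {hb : ∀ i, w i ≤ b}
    {h1 : ∀ i < m, ∀ j < m, i + j < m → w (i + j) ≤ w i + w j}
    {h2 : ∀ i < m, ∀ j < m, m ≤ i + j → w (i + j - m) ≤ w i + w j + 1} {k i : ℕ} (hi : i < m) :
    k * m + i ∈ (ofWord m b w hm h0 hb h1 h2).carrier ↔ w i ≤ k := by
  change w ((k * m + i) % m) ≤ (k * m + i) / m ↔ _
  rw [Nat.mul_add_mod_self_right, Nat.mod_eq_of_lt hi, Nat.add_comm, Nat.add_mul_div_right _ _ hm, Nat.div_eq_of_lt hi,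
    zero_add]

/-- The letter q at r with smaller letters beyond makes (q-1)m + r the last gap; positive letters
keep the multiplicity equal to m. -/
theorem ofWord_mem_ofDepthFrobenius {m q r : ℕ} {w : ℕ → ℕ} (hm : 0 < m) (h0 : w 0 = 0)
    (hb : ∀ i, w i ≤ q)
    (h1 : ∀ i < m, ∀ j < m, i + j < m → w (i + j) ≤ w i + w j)
    (h2 : ∀ i < m, ∀ j < m, m ≤ i + j → w (i + j - m) ≤ w i + w j + 1) (hq : 0 < q)
    (hr : r < m) (hwr : w r = q) (hwgt : ∀ i < m, r < i → w i ≤ q - 1)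
    (hpos : ∀ i < m, 0 < i → 0 < w i) :
    ofWord m q w hm h0 hb h1 h2 ∈ ofDepthFrobenius q ((q - 1) * m + r) := by
  set Λ := ofWord m q w hm h0 hb h1 h2 with hΛ
  have hqm : q * m = (q - 1) * m + m := by
    obtain ⟨p, rfl⟩ : ∃ p, q = p + 1 := ⟨q - 1, by omega⟩
    simp only [Nat.add_sub_cancel]
    ring
  have hmult : Λ.multiplicity = m := by
    refine le_antisymm (Nat.sInf_le ⟨?_, hm.ne'⟩) ?_
    · have := (mul_add_mem_ofWord (k := 1) (i := 0) (hm := hm) (h0 := h0) (hb := hb) (h1 := h1)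
        (h2 := h2) hm).2 (by omega)
      simpa using this
    · by_contra h
      have h3 := Λ.multiplicity_mem
      have h4 := (mul_add_mem_ofWord (k := 0) (hm := hm) (h0 := h0) (hb := hb) (h1 := h1)
        (h2 := h2) (not_le.1 h)).1 (by simpa using h3.1)
      have := hpos _ (not_le.1 h) Λ.multiplicity_pos
      omega
  have hcond : Λ.conductor = (q - 1) * m + r + 1 := by
    refine le_antisymm (Nat.sInf_le fun n => ?_) ?_
    · have h3 := Nat.div_add_mod' ((q - 1) * m + r + 1 + n) m
      have h4 := Nat.mod_lt ((q - 1) * m + r + 1 + n) hm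
      rw [← h3, mul_add_mem_ofWord h4]
      set i := ((q - 1) * m + r + 1 + n) % m
      set k := ((q - 1) * m + r + 1 + n) / m
      have hk : q - 1 ≤ k := by
        rw [Nat.le_div_iff_mul_le hm]; omega
      by_cases hkq : q ≤ k
      · exact (hb i).trans hkq
      · have : k = q - 1 := by omega
        rw [this] at h3 ⊢
        exact hwgt i h4 (by omega)
    · by_contra h
      have h3 := (mul_add_mem_ofWord (k := q - 1) (hm := hm) (h0 := h0) (hb := hb) (h1 := h1)
        (h2 := h2) hr).1 (Λ.mem_of_conductor_le (by omega))
      omega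
  refine ⟨(Λ.depth_eq_iff hq).2 ?_, ?_⟩
  · rw [hmult, hcond]
    omega
  · rw [frobenius, hcond]
    push_cast
    ring

/-! ### Lower bound by explicit words -/

/-- Lower bounds for the letters beyond `r` under which the Kunz inequalities are automatic. -/
def halvesLower (q m r i : ℕ) : ℕ := if i ≤ (m + r) / 2 then q / 2 else (q - 1) / 2

-- The two halves beyond r allow q - ⌊q/2⌋ and q - ⌊(q-1)/2⌋ letters per position, and the product
-- of these is exactly Q(q-1).
open Finset in
theorem pow_quarterSq_le_card_finsupp {q m r : ℕ} (hq : 0 < q) (hr : r < m) :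
    quarterSq (q - 1) ^ ((m - r - 1) / 2) ≤
      #((Ico (r + 1) m).finsupp (fun i => Ico (halvesLower q m r i) q)) := by
  have hsplit : Ico (r + 1) m = Ico (r + 1) ((m + r) / 2 + 1) ∪ Ico ((m + r) / 2 + 1) m :=
    (Ico_union_Ico_eq_Ico (by omega) (by omega)).symm
  rw [card_finsupp, hsplit, prod_union (Ico_disjoint_Ico_consecutive _ _ _)]
  have hlow : ∏ i ∈ Ico (r + 1) ((m + r) / 2 + 1), #(Ico (halvesLower q m r i) q) =
      (q - q / 2) ^ ((m + r) / 2 - r) := by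
    rw [prod_congr rfl (g := fun _ => q - q / 2) fun i hi => ?_, prod_const, Nat.card_Ico,
      Nat.add_sub_add_right]
    have := mem_Ico.1 hi
    rw [Nat.card_Ico, halvesLower, if_pos (by omega)]
  have hupp : ∏ i ∈ Ico ((m + r) / 2 + 1) m, #(Ico (halvesLower q m r i) q) =
      (q - (q - 1) / 2) ^ (m - ((m + r) / 2 + 1)) := by
    rw [prod_congr rfl (g := fun _ => q - (q - 1) / 2) fun i hi => ?_, prod_const, Nat.card_Ico]
    have := mem_Ico.1 hi
    rw [Nat.card_Ico, halvesLower, if_neg (by omega)]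
  rw [hlow, hupp]
  have hQ : quarterSq (q - 1) = (q - q / 2) * (q - (q - 1) / 2) := by
    rw [quarterSq]
    rcases Nat.even_or_odd' q with ⟨c, rfl | rfl⟩
    · have e1 : 2 * c - 1 + 2 = 2 * c + 1 := by omega
      have e2 : 2 * c - 2 * c / 2 = c := by omega
      have e3 : 2 * c - (2 * c - 1) / 2 = c + 1 := by omega
      have e4 : (2 * c + 1) ^ 2 = 4 * (c * (c + 1)) + 1 := by ring
      rw [e1, e2, e3, e4]
      omega
    · have e1 : 2 * c + 1 - 1 + 2 = 2 * (c + 1) := by omega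
      have e2 : 2 * c + 1 - (2 * c + 1) / 2 = c + 1 := by omega
      have e3 : 2 * c + 1 - (2 * c + 1 - 1) / 2 = c + 1 := by omega
      have e4 : (2 * (c + 1)) ^ 2 = 4 * ((c + 1) * (c + 1)) := by ring
      rw [e1, e2, e3, e4]
      omega
  rw [hQ, mul_pow]
  refine Nat.mul_le_mul (Nat.pow_le_pow_right (by omega) (by omega))
    (Nat.pow_le_pow_right (by omega) (by omega))

open Finset in
/-- A lower bound for the number of semigroups with `f = (q - 1) m + r`: all letters up to `r` are
`q`, and the others are at least about `q / 2`. -/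
theorem pow_quarterSq_le_ncard {q m r : ℕ} (hq : 3 ≤ q) (hr0 : 0 < r) (hr : r < m) :
    quarterSq (q - 1) ^ ((m - r - 1) / 2) ≤ (ofDepthFrobenius q ((q - 1) * m + r)).ncard := by
  classical
  refine (pow_quarterSq_le_card_finsupp (by omega) hr).trans ?_
  rw [← Set.ncard_coe_finset]
  set W := (Ico (r + 1) m).finsupp (fun i => Ico (halvesLower q m r i) q) with hW
  let w : (ℕ →₀ ℕ) → ℕ → ℕ := fun k i => if i = 0 then 0 else if i ≤ r then q else k i
  have hw0 : ∀ k, w k 0 = 0 := fun k => by simp [w]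
  have hwle : ∀ k i, 0 < i → i ≤ r → w k i = q := fun k i h1 h2 => by
    simp only [w, if_neg h1.ne', if_pos h2]
  have hwgt : ∀ k i, r < i → w k i = k i := fun k i h1 => by
    simp only [w, if_neg (by omega : ¬ i = 0), if_neg (by omega : ¬ i ≤ r)]
  have hk : ∀ k ∈ W, ∀ i, r < i → i < m →
      (i ≤ (m + r) / 2 → q / 2 ≤ k i) ∧ (q - 1) / 2 ≤ k i ∧ k i ≤ q - 1 := by
    intro k hk i h1 h2
    have h3 := mem_Ico.1 ((mem_finsupp_iff.1 hk).2 i (mem_Ico.2 ⟨h1, h2⟩))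
    rw [halvesLower] at h3
    split_ifs at h3 with h4
    · exact ⟨fun _ => h3.1, by omega, by omega⟩
    · exact ⟨fun h => absurd h h4, by omega, by omega⟩
  have hout : ∀ k ∈ W, ∀ i, ¬ (r < i ∧ i < m) → k i = 0 := fun k hk i hi => by
    refine Finsupp.notMem_support_iff.1 fun h => hi ?_
    have := mem_Ico.1 ((mem_finsupp_iff.1 hk).1 h)
    omega
  have hcases : ∀ k ∈ W, ∀ i < m, (i = 0 ∧ w k i = 0) ∨ (0 < i ∧ i ≤ r ∧ w k i = q) ∨
      (r < i ∧ i ≤ (m + r) / 2 ∧ q / 2 ≤ w k i ∧ w k i ≤ q - 1) ∨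
      ((m + r) / 2 < i ∧ (q - 1) / 2 ≤ w k i ∧ w k i ≤ q - 1) := by
    intro k hkW i him
    rcases Nat.eq_zero_or_pos i with rfl | hi
    · exact Or.inl ⟨rfl, hw0 k⟩
    by_cases hir : i ≤ r
    · exact Or.inr (Or.inl ⟨hi, hir, hwle k i hi hir⟩)
    have h1 := hk k hkW i (by omega) him
    rw [hwgt k i (by omega)]
    by_cases hih : i ≤ (m + r) / 2
    · exact Or.inr (Or.inr (Or.inl ⟨by omega, hih, h1.1 hih, h1.2.2⟩))
    · exact Or.inr (Or.inr (Or.inr ⟨by omega, h1.2.1, h1.2.2⟩))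
  have hb : ∀ k ∈ W, ∀ i, w k i ≤ q := by
    intro k hkW i
    by_cases him : i < m
    · rcases hcases k hkW i him with h | h | h | h <;> omega
    · rw [hwgt k i (by omega), hout k hkW i (by omega)]
      omega
  -- If i, j > r and i + j < m, they cannot both exceed (m+r)/2, so the letters sum to at least
  -- ⌊q/2⌋ + ⌊(q-1)/2⌋ = q - 1.
  have h1 : ∀ k ∈ W, ∀ i < m, ∀ j < m, i + j < m → w k (i + j) ≤ w k i + w k j := by
    intro k hkW i hi j hj hij
    rcases Nat.eq_zero_or_pos i with rfl | hi0
    · simp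
    rcases Nat.eq_zero_or_pos j with rfl | hj0
    · simp
    rcases hcases k hkW i hi with h | h | h | h <;>
    rcases hcases k hkW j hj with h' | h' | h' | h' <;>
    rcases hcases k hkW _ hij with h'' | h'' | h'' | h'' <;> omega
  -- A target letter q needs i + j ≤ m + r, so one index is at most (m+r)/2 and the right side is at
  -- least q. Otherwise the target is at most q - 1 ≤ 2⌊(q-1)/2⌋ + 1.
  have h2 : ∀ k ∈ W, ∀ i < m, ∀ j < m, m ≤ i + j → w k (i + j - m) ≤ w k i + w k j + 1 := by
    intro k hkW i hi j hj hij
    rcases hcases k hkW i hi with h | h | h | h <;>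
    rcases hcases k hkW j hj with h' | h' | h' | h' <;>
    rcases hcases k hkW (i + j - m) (by omega) with h'' | h'' | h'' | h'' <;> omega
  have hm : 0 < m := by omega
  refine Set.ncard_le_ncard_of_injOn (fun k => if hkW : k ∈ W then
    ofWord m q (w k) hm (hw0 k) (hb k hkW) (h1 k hkW) (h2 k hkW) else
    ⟨⊤, by change ((Set.univ : Set ℕ)ᶜ).Finite; simp⟩) ?_ ?_
    (finite_ofDepthFrobenius _ _)
  · intro k hkW
    rw [Finset.mem_coe] at hkW
    simp only [dif_pos hkW]
    refine ofWord_mem_ofDepthFrobenius hm _ _ _ _ (by omega) hr (hwle k r hr0 le_rfl) ?_ ?_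
    · intro i him hri
      rw [hwgt k i hri]
      exact (hk k hkW i hri him).2.2
    -- Letters are positive since q ≥ 3 gives ⌊(q-1)/2⌋ ≥ 1.
    · intro i him hi0
      rcases hcases k hkW i him with h | h | h | h <;> omega
  · intro k hkW k' hkW' heq
    rw [Finset.mem_coe] at hkW hkW'
    simp only [dif_pos hkW, dif_pos hkW'] at heq
    ext i
    by_cases hi : r < i ∧ i < m
    · have key : ∀ c, k i ≤ c ↔ k' i ≤ c := fun c => by
        rw [← hwgt k i hi.1, ← hwgt k' i hi.1]
        rw [← mul_add_mem_ofWord (hm := hm) (h0 := hw0 k) (hb := hb k hkW) (h1 := h1 k hkW)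
          (h2 := h2 k hkW) hi.2, heq, mul_add_mem_ofWord hi.2]
      exact le_antisymm ((key _).2 le_rfl) ((key _).1 le_rfl)
    · rw [hout k hkW i hi, hout k' hkW' i hi]

/-- The number of semigroups of depth `q` and Frobenius number `f` is at least
`quarterSq (q - 1) ^ (f / (2 (q - 1)) - O(1))`. -/
theorem exists_exp_le_ncard {q : ℕ} (hq : 3 ≤ q) : ∃ C : ℝ, ∀ᶠ f : ℕ in atTop,
    Real.exp (f / (2 * (q - 1)) * Real.log (quarterSq (q - 1)) - C) ≤
      ((ofDepthFrobenius q f).ncard : ℝ) := by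
  refine ⟨(q + 2) / 2 * Real.log (quarterSq (q - 1)), ?_⟩
  filter_upwards [eventually_ge_atTop (q * q + 1)] with f hf
  have hq1 : 0 < q - 1 := by omega
  -- Dividing f - 1 rather than f puts r in [1, q-1], avoiding r = 0.
  set m := (f - 1) / (q - 1) with hm
  set r := (f - 1) % (q - 1) + 1 with hr
  have hfm : f = (q - 1) * m + r := by
    have : (q - 1) * m + (f - 1) % (q - 1) = f - 1 := Nat.div_add_mod (f - 1) (q - 1)
    omega
  have hrq : r ≤ q - 1 := Nat.mod_lt (f - 1) hq1
  have hmq : q ≤ m := by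
    rw [hm, Nat.le_div_iff_mul_le hq1]
    have : q * (q - 1) ≤ q * q := Nat.mul_le_mul_left _ (Nat.sub_le _ _)
    omega
  have hmain := pow_quarterSq_le_ncard hq (Nat.succ_pos _ : 0 < r) (by omega : r < m)
  rw [← hfm] at hmain
  have hQ0 : (0 : ℝ) < quarterSq (q - 1) := by
    exact_mod_cast (Nat.succ_pos _).trans_le (succ_le_quarterSq (q - 1))
  refine le_trans ?_ (Nat.cast_le.2 hmain)
  rw [Nat.cast_pow, ← Real.exp_log (pow_pos hQ0 _), Real.log_pow, ← sub_mul]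
  refine Real.exp_le_exp.2 (mul_le_mul_of_nonneg_right ?_ (log_quarterSq_nonneg _))
  have hq1' : (0 : ℝ) < q - 1 := by
    have : (3 : ℝ) ≤ q := by exact_mod_cast hq
    linarith
  have e1 : (f : ℝ) ≤ (q - 1) * m + (q - 1) := by
    have h : (f : ℝ) = ((q - 1 : ℕ) : ℝ) * m + r := by exact_mod_cast hfm
    rw [Nat.cast_sub (by omega), Nat.cast_one] at h
    have h' : (r : ℝ) ≤ ((q - 1 : ℕ) : ℝ) := by exact_mod_cast hrq
    rw [Nat.cast_sub (by omega), Nat.cast_one] at h'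
    linarith
  have e2 : (f : ℝ) / (2 * (q - 1)) ≤ (m + 1) / 2 := by
    rw [div_le_div_iff₀ (by positivity) (by norm_num)]
    linarith
  have e3 : (m : ℝ) ≤ 2 * ((m - r - 1) / 2 : ℕ) + q + 1 := by
    exact_mod_cast (by omega : m ≤ 2 * ((m - r - 1) / 2) + q + 1)
  linarith

/-! ### Rarity of large r and the limit -/

instance : DiscreteMeasurableSpace NumericalSemigroup := ⟨fun _ => trivial⟩

/-- Eliminating m at fixed f isolates the cost of a large r. -/
theorem kunzExponent_eq {m q r f : ℕ} (hq : 1 < q) (hf : f = (q - 1) * m + r) :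
    kunzExponent m q r = f / (2 * (q - 1)) * Real.log (quarterSq (q - 1)) -
      r / (2 * (q - 1)) * (q * Real.log (quarterSq (q - 1)) - (q - 1) * Real.log (quarterSq q)) := by
  have hq1 : (0 : ℝ) < q - 1 := by
    have : (1 : ℝ) < q := by exact_mod_cast hq
    linarith
  rw [hf]
  push_cast
  rw [Nat.cast_sub hq.le, Nat.cast_one, kunzExponent]
  field_simp
  ring

open Finset in
/-- Semigroups for which `f - (q - 1) m ≥ ε f` are exponentially rare. -/
theorem exists_ncard_atypical_le {q : ℕ} (hq : 3 ≤ q) {ε : ℝ} (hε : 0 < ε) :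
    ∃ C c : ℝ, 0 < c ∧ ∀ f : ℕ, 0 < f →
      (({Λ ∈ ofDepthFrobenius q f |
        ε * f ≤ |(f : ℝ) - ((q : ℝ) - 1) * (Λ.multiplicity : ℝ)|}).ncard : ℝ) ≤
      (f + 1) * Real.exp (C + f / (2 * (q - 1)) * Real.log (quarterSq (q - 1)) - c * f) := by
  classical
  have hq1 : (0 : ℝ) < q - 1 := by
    have : (3 : ℝ) ≤ q := by exact_mod_cast hq
    linarith
  have hgap := sub_pos.2 (mul_log_quarterSq_lt hq)
  set g := q * Real.log (quarterSq (q - 1)) - (q - 1) * Real.log (quarterSq q) with hg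
  -- With c = β, having r ≥ εf lowers the exponent by at least 2cf. The error βm ≤ cf uses up half
  -- of this.
  obtain ⟨C, hC⟩ := exists_card_kunzWords_le (q := q) (by omega)
    (β := ε * g / (4 * (q - 1))) (by positivity)
  refine ⟨C, ε * g / (4 * (q - 1)), by positivity, fun f hf => ?_⟩
  set c := ε * g / (4 * (q - 1)) with hc
  have hc0 : 0 < c := by positivity
  have hf0 : (0 : ℝ) < f := by exact_mod_cast hf
  set P := (range (f + 1)).filter (fun m => 2 ≤ m ∧ f < (q - 1) * m + m ∧ (q - 1) * m ≤ f ∧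
    ε * f ≤ (f - (q - 1) * m : ℕ)) with hP
  set T := P.sigma (fun m => kunzWords m q (f - (q - 1) * m)) with hT
  have hle : ({Λ ∈ ofDepthFrobenius q f |
      ε * f ≤ |(f : ℝ) - ((q : ℝ) - 1) * (Λ.multiplicity : ℝ)|}).ncard ≤ #T := by
    rw [← Set.ncard_coe_finset]
    refine Set.ncard_le_ncard_of_injOn (fun Λ => ⟨Λ.multiplicity, Λ.kunzWord⟩) ?_ ?_
      (Finset.finite_toSet T)
    · rintro Λ ⟨⟨hd, hfr⟩, hfar⟩
      rw [Λ.depth_eq_iff (by omega)] at hd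
      have hcond : Λ.conductor = f + 1 := by
        rw [frobenius] at hfr
        omega
      rw [hcond] at hd
      have hqm : q * Λ.multiplicity = (q - 1) * Λ.multiplicity + Λ.multiplicity := by
        obtain ⟨p, rfl⟩ : ∃ p, q = p + 1 := ⟨q - 1, by omega⟩
        simp only [Nat.add_sub_cancel]
        ring
      have hmf : Λ.multiplicity ≤ (q - 1) * Λ.multiplicity := Nat.le_mul_of_pos_left _ (by omega)
      -- Depth q forces f ≥ (q-1)m, so the deviation is one-sided.
      have hlow : (q - 1) * Λ.multiplicity ≤ f := by omega
      have hcast : ((f - (q - 1) * Λ.multiplicity : ℕ) : ℝ) =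
          (f : ℝ) - ((q : ℝ) - 1) * Λ.multiplicity := by
        rw [Nat.cast_sub hlow, Nat.cast_mul, Nat.cast_sub (by omega), Nat.cast_one]
      rw [← hcast, abs_of_nonneg (Nat.cast_nonneg _)] at hfar
      have hrpos : 0 < f - (q - 1) * Λ.multiplicity := by
        have : (0 : ℝ) < (f - (q - 1) * Λ.multiplicity : ℕ) :=
          (mul_pos hε hf0).trans_le hfar
        exact_mod_cast this
      refine mem_sigma.2 ⟨mem_filter.2 ⟨mem_range.2 ?_, ?_, ?_, hlow, hfar⟩, ?_⟩
      · change Λ.multiplicity < f + 1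
        omega
      · change 2 ≤ Λ.multiplicity
        omega
      · change f < (q - 1) * Λ.multiplicity + Λ.multiplicity
        omega
      · change Λ.kunzWord ∈ kunzWords Λ.multiplicity q (f - (q - 1) * Λ.multiplicity)
        exact Λ.kunzWord_mem_kunzWords (by omega) (by omega) (by omega)
    · rintro Λ - Λ' - h
      simp only [Sigma.mk.injEq, heq_eq_eq] at h
      exact eq_of_kunzWord_eq h.1 h.2
  refine (Nat.cast_le.2 hle).trans ?_
  rw [hT, card_sigma, Nat.cast_sum]
  have hterm : ∀ m ∈ P, (#(kunzWords m q (f - (q - 1) * m)) : ℝ) ≤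
      Real.exp (C + f / (2 * (q - 1)) * Real.log (quarterSq (q - 1)) - c * f) := by
    intro m hm
    obtain ⟨hmr, hm2, hmf, hlow, hfar⟩ := mem_filter.1 hm
    refine (hC m _ hm2 (by omega)).trans (Real.exp_le_exp.2 ?_)
    rw [kunzExponent_eq (by omega) (Nat.add_sub_cancel' hlow).symm, ← hg]
    have h1 : c * m ≤ c * f := by
      have := mem_range.1 hmr
      have : (m : ℝ) ≤ f := by exact_mod_cast (by omega : m ≤ f)
      gcongr
    have h2 : ε * f / (2 * (q - 1)) * g ≤
        ((f - (q - 1) * m : ℕ) : ℝ) / (2 * (q - 1)) * g := by gcongr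
    have h3 : ε * f / (2 * (q - 1)) * g = 2 * (c * f) := by
      rw [hc]; field_simp; norm_num
    linarith
  refine (sum_le_sum hterm).trans ?_
  rw [sum_const, nsmul_eq_mul]
  have hPc : (#P : ℝ) ≤ f + 1 := by
    have : #P ≤ #(range (f + 1)) := card_filter_le _ _
    rw [card_range] at this
    exact_mod_cast this
  gcongr

theorem uniformOn_real_eq {S : Set NumericalSemigroup} (hS : S.Finite) (hne : S.Nonempty)
    (T : Set NumericalSemigroup) :
    (ProbabilityTheory.uniformOn S).real T = 1 - ((S ∩ Tᶜ).ncard : ℝ) / S.ncard := by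
  have := ProbabilityTheory.isProbabilityMeasure_uniformOn' hS hne (MeasurableSet.of_discrete)
  have hT : MeasurableSet T := MeasurableSet.of_discrete
  have hcompl := MeasureTheory.probReal_compl_eq_one_sub
    (μ := ProbabilityTheory.uniformOn S) hT
  have hcount : (ProbabilityTheory.uniformOn S).real Tᶜ =
      ((S ∩ Tᶜ).ncard : ℝ) / S.ncard := by
    rw [MeasureTheory.Measure.real, ProbabilityTheory.uniformOn,
      ProbabilityTheory.cond_apply MeasurableSet.of_discrete,
      MeasureTheory.Measure.count_apply_finite' hS MeasurableSet.of_discrete,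
      MeasureTheory.Measure.count_apply_finite' (hS.subset Set.inter_subset_left)
        MeasurableSet.of_discrete,
      Set.ncard_eq_toFinset_card _ hS,
      Set.ncard_eq_toFinset_card _ (hS.subset Set.inter_subset_left)]
    simp [div_eq_inv_mul]
  linarith

end NumericalSemigroup

theorem mainTheorem9 (q : ℕ) (hq : 3 ≤ q) (ε : ℝ) (hε : 0 < ε) :
    Tendsto
      (fun f : ℕ =>
        (ProbabilityTheory.uniformOn (NumericalSemigroup.ofDepthFrobenius q f)).real
          {Λ : NumericalSemigroup |
            |(f : ℝ) - ((q : ℝ) - 1) * (Λ.multiplicity : ℝ)| < ε * (f : ℝ)})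
      atTop (𝓝 1) := by
  obtain ⟨C, c, hc, hupper⟩ := NumericalSemigroup.exists_ncard_atypical_le hq hε
  obtain ⟨C', hlower⟩ := NumericalSemigroup.exists_exp_le_ncard hq
  -- In the ratio of the upper to the lower bound the common main exponential cancels, leaving (f+1)
  -- exp(C + C' - cf).
  have hlim : Tendsto (fun f : ℕ => (1 : ℝ) - ((f : ℝ) + 1) * Real.exp (-(c * f)) *
      Real.exp (C + C')) atTop (𝓝 1) := by
    have h1 : Tendsto (fun x : ℝ => x * Real.exp (-(c * x))) atTop (𝓝 0) := by
      have := Real.tendsto_pow_mul_exp_neg_atTop_nhds_zero 1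
      have h2 := (this.comp (tendsto_id.const_mul_atTop hc)).const_mul c⁻¹
      simp only [mul_zero] at h2
      refine h2.congr fun x => ?_
      simp only [Function.comp, id, pow_one]
      field_simp
    have h2 : Tendsto (fun x : ℝ => Real.exp (-(c * x))) atTop (𝓝 0) :=
      Real.tendsto_exp_neg_atTop_nhds_zero.comp (tendsto_id.const_mul_atTop hc)
    have h3 := (((h1.add h2).mul_const (Real.exp (C + C'))).const_sub 1).comp
      (tendsto_natCast_atTop_atTop (R := ℝ))
    simp only [add_zero, zero_mul, sub_zero] at h3
    refine h3.congr fun f => ?_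
    simp only [Function.comp]
    ring
  refine tendsto_of_tendsto_of_tendsto_of_le_of_le' hlim tendsto_const_nhds ?_ ?_
  · filter_upwards [hlower, eventually_gt_atTop 0] with f hf hf0
    have hpos : (0 : ℝ) < (NumericalSemigroup.ofDepthFrobenius q f).ncard :=
      (Real.exp_pos _).trans_le hf
    have hne : (NumericalSemigroup.ofDepthFrobenius q f).Nonempty :=
      Set.nonempty_of_ncard_ne_zero (by exact_mod_cast hpos.ne')
    rw [NumericalSemigroup.uniformOn_real_eq (NumericalSemigroup.finite_ofDepthFrobenius q f) hne]
    refine sub_le_sub_left ?_ _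
    rw [div_le_iff₀ hpos]
    have hset : NumericalSemigroup.ofDepthFrobenius q f ∩ {Λ : NumericalSemigroup |
        |(f : ℝ) - ((q : ℝ) - 1) * (Λ.multiplicity : ℝ)| < ε * (f : ℝ)}ᶜ =
        {Λ ∈ NumericalSemigroup.ofDepthFrobenius q f |
          ε * f ≤ |(f : ℝ) - ((q : ℝ) - 1) * (Λ.multiplicity : ℝ)|} := by
      ext Λ
      simp
    rw [hset]
    refine (hupper f hf0).trans ?_
    refine le_trans (le_of_eq ?_) (mul_le_mul_of_nonneg_left hf (by positivity))
    rw [mul_assoc, mul_assoc, ← Real.exp_add, ← Real.exp_add]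
    congr 2
    ring
  · exact Eventually.of_forall fun f => MeasureTheory.measureReal_le_one
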